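/- **Setting.** Let $\mathcal K\subseteq C^\infty(\mathbb R,\mathbb R^m)$ be the space of smooth trajectories all of whose derivatives obey a fixed translation-invariant growth condition (no condition at all being allowed, in which case $\mathcal K=C^\infty(\mathbb R,\mathbb R^m)$), let $(T_\tau q)(\sigma)=q(\tau+\sigma)$, and let $\mathcal L:\mathcal K\times\mathbb R\to\mathbb R$ be a (non-local, possibly explicitly time-dependent) Lagrangian that is smooth along smooth finite-dimensional families in $\mathcal K\times\mathbb R$. Put $$\Lambda(q,t,\tau,\sigma)=\frac{\delta\mathcal L(T_\tau q,t+\tau)}{\delta q(\sigma)},\qquad \Psi(q,t,\sigma)=\int_{\mathbb R}\Lambda(q,t,\tau,\sigma)\,d\tau,\qquad \mathcal D'=\{(q,t):\Psi(q,t,\cdot)=0\}.$$ $\Lambda$ may be a distribution in $\sigma$; a product with differences of Heaviside functions $\theta$ is the limit of the products in which $\theta$ is replaced by smooth steps $0\le\chi\le1$ with transition interval $[-\varepsilon,\varepsilon]$, $\varepsilon\to0$ (the same step at each occurrence). It is assumed that the integrals over $\tau$ of $\int[\chi(\sigma)-\chi(\tau)]\,\Lambda(q,t,\tau,\sigma)\,\eta(\sigma)\,d\sigma$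 converge absolutely, locally uniformly along smooth curves $(q_s,\eta_s,t_s)$, together with the $s$-derivative of the integrand. On the extended phase space $\Gamma'$ of points $(q,\pi,t)$, with $\pi$ a covector on $\mathcal K$ (written as a generalized function, $\pi(\eta)=\int\pi(\sigma)\eta(\sigma)\,d\sigma$), let $$H(q,\pi,t)=\int\pi(\sigma)\,\dot q(\sigma)\,d\sigma-\mathcal L(q,t),\qquad \Omega'=\Omega-\delta H\wedge\delta t,\qquad \Omega=\int\delta\pi(\sigma)\wedge\delta q(\sigma)\,d\sigma,$$ and let $j:\mathcal D'\to\Gamma'$, $j(q,t)=(q,P(q,t),t)$ with $$P(q,t)(\sigma)=\int[\theta(\sigma)-\theta(\tau)]\,\Lambda(q,t,\tau,\sigma)\,d\tau .$$ Let $\mathbf X=\partial_t+\int d\sigma\,\dot q(\sigma)\,\delta/\delta q(\sigma)$ be the generator of time evolution $(q,t)\mapsto(T_\varepsilon q,t+\varepsilon)$. Tangent vectors to $\mathcal D'$ are velocities of smooth curves in $\mathcal D'$; $(\alpha\wedge\beta)(V,Z)=\alpha(V)\beta(Z)-\alpha(Z)\beta(V)$. **Statement.** The momentum $P(q,t)$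 exists for every $(q,t)\in\mathcal D'$; $j$ and $h=H\circ j$ are differentiable on $\mathcal D'$ (their derivatives along curves in $\mathcal D'$ exist and depend only on the velocity); and $\omega'=j^*\Omega'$ is a 2-form on $\mathcal D'$ (skew-symmetric, and linear in each argument wherever the tangent vectors involved are tangent to $\mathcal D'$) such that: 1. $\omega'=\omega-\delta h\wedge\delta t$, where $\omega=j^*\Omega=\int\delta P(q,t)(\sigma)\wedge\delta q(\sigma)\,d\sigma$; 2. $\displaystyle h(q,t)=\iint[\theta(\sigma)-\theta(\tau)]\,\dot q(\sigma)\,\Lambda(q,t,\tau,\sigma)\,d\tau\,d\sigma-\mathcal L(q,t)$; 3. $\displaystyle \omega=\frac12\iiint\frac{\delta\Lambda(q,t,\tau,\sigma)}{\delta q(\rho)}\,[\theta(\sigma)-\theta(\rho)]\,\delta q(\rho)\wedge\delta q(\sigma)\,d\tau\,d\sigma\,d\rho+\iint[\theta(\sigma)-\theta(\tau)]\,\frac{\partial\Lambda(q,t,\tau,\sigma)}{\partial t}\,\delta t\wedge\delta q(\sigma)\,d\tau\,d\sigma$ (the limit being taken of the sum); the second integral is absent, and the first converges alone, when $\mathcal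 L$ does not depend explicitly on $t$, and also on pairs of tangent vectors with $\delta t=0$; 4. $\mathbf X$ is tangent to $\mathcal D'$, being the velocity of the curve $\varepsilon\mapsto(T_\varepsilon q,t+\varepsilon)$, which stays in $\mathcal D'$, and $i_{\mathbf X}\omega'=0$. -/

import Mathlib

open Filter MeasureTheory
open scoped ContDiff Topology

noncomputable section

namespace NonlocalMechanics

/-! ### Trajectories -/

/-- A growth condition: a family of nonnegative majorants. Taking all continuous nonnegative
functions imposes no condition, and then the kinematic space below is all of
`C^∞(ℝ, ℝ^m)`; a smaller family, such as `C * exp (r * |σ|)` with `r < 1`, restricts to the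
trajectories on which the Lagrangian under study is defined. -/
structure GrowthClass where
  bounds : Set (ℝ → ℝ)
  nonneg : ∀ f ∈ bounds, ∀ σ, 0 ≤ f σ
  add_le : ∀ f ∈ bounds, ∀ g ∈ bounds, ∃ h ∈ bounds, ∀ σ, f σ + g σ ≤ h σ
  translate_le : ∀ f ∈ bounds, ∀ R : ℝ, ∃ h ∈ bounds, ∀ τ, |τ| ≤ R → ∀ σ, f (σ + τ) ≤ h σ
  locally_pos : ∀ R : ℝ, ∃ f ∈ bounds, ∀ σ, |σ| ≤ R → 1 ≤ f σ

theorem GrowthClass.mul_le (W : GrowthClass) (C : ℝ) {f : ℝ → ℝ} (hf : f ∈ W.bounds) :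
    ∃ h ∈ W.bounds, ∀ σ, C * f σ ≤ h σ := by
  have key : ∀ n : ℕ, ∃ h ∈ W.bounds, ∀ σ, (n : ℝ) * f σ ≤ h σ := by
    intro n
    induction n with
    | zero => exact ⟨f, hf, fun σ => by simpa using W.nonneg f hf σ⟩
    | succ n ih =>
      obtain ⟨h, hh, hle⟩ := ih
      obtain ⟨k, hk, hkle⟩ := W.add_le h hh f hf
      refine ⟨k, hk, fun σ => ?_⟩
      have h1 := hle σ
      have h2 := hkle σ
      push_cast
      linarith
  obtain ⟨n, hn⟩ := exists_nat_ge C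
  obtain ⟨h, hh, hle⟩ := key n
  exact ⟨h, hh, fun σ => (mul_le_mul_of_nonneg_right hn (W.nonneg f hf σ)).trans (hle σ)⟩

theorem GrowthClass.sum_le (W : GrowthClass) (n : ℕ) (F : ℕ → ℝ → ℝ)
    (hF : ∀ i, F i ∈ W.bounds) :
    ∃ h ∈ W.bounds, ∀ σ, ∑ i ∈ Finset.range n, F i σ ≤ h σ := by
  induction n with
  | zero => exact ⟨F 0, hF 0, fun σ => by simpa using W.nonneg _ (hF 0) σ⟩
  | succ n ih =>
    obtain ⟨h, hh, hle⟩ := ih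
    obtain ⟨k, hk, hkle⟩ := W.add_le h hh (F n) (hF n)
    refine ⟨k, hk, fun σ => ?_⟩
    rw [Finset.sum_range_succ]
    have h1 := hle σ
    have h2 := hkle σ
    linarith

/-- The kinematic space: smooth trajectories all of whose derivatives obey the growth
condition. -/
def KinematicSpace (W : GrowthClass) (m : ℕ) : Submodule ℝ (ℝ → Fin m → ℝ) where
  carrier := {q | ContDiff ℝ ∞ q ∧
    ∀ k : ℕ, ∃ f ∈ W.bounds, ∀ σ, ‖iteratedFDeriv ℝ k q σ‖ ≤ f σ}
  zero_mem' := by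
    refine ⟨contDiff_const, fun k => ?_⟩
    obtain ⟨f, hf, -⟩ := W.locally_pos 0
    refine ⟨f, hf, fun σ => ?_⟩
    have : iteratedFDeriv ℝ k (0 : ℝ → Fin m → ℝ) σ = 0 := by
      rw [iteratedFDeriv_zero]; rfl
    rw [this, norm_zero]
    exact W.nonneg f hf σ
  add_mem' := by
    rintro a b ⟨ha, ha'⟩ ⟨hb, hb'⟩
    refine ⟨ha.add hb, fun k => ?_⟩
    obtain ⟨f, hf, hfle⟩ := ha' k
    obtain ⟨g, hg, hgle⟩ := hb' k
    obtain ⟨h, hh, hle⟩ := W.add_le f hf g hg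
    refine ⟨h, hh, fun σ => ?_⟩
    rw [iteratedFDeriv_add (ha.of_le (by exact_mod_cast le_top))
      (hb.of_le (by exact_mod_cast le_top))]
    exact (norm_add_le _ _).trans ((add_le_add (hfle σ) (hgle σ)).trans (hle σ))
  smul_mem' := by
    rintro c a ⟨ha, ha'⟩
    refine ⟨contDiff_const.smul ha, fun k => ?_⟩
    obtain ⟨f, hf, hfle⟩ := ha' k
    obtain ⟨h, hh, hle⟩ := W.mul_le ‖c‖ hf
    refine ⟨h, hh, fun σ => ?_⟩
    rw [iteratedFDeriv_const_smul_apply (ha.contDiffAt.of_le (by exact_mod_cast le_top)),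
      norm_smul]
    exact (mul_le_mul_of_nonneg_left (hfle σ) (norm_nonneg c)).trans (hle σ)

variable {W : GrowthClass} {m : ℕ}

/-- Time translation `(T_τ q)(σ) = q (τ + σ)`. -/
def shift (τ : ℝ) (q : KinematicSpace W m) : KinematicSpace W m :=
  ⟨fun σ => q.1 (τ + σ), by
    refine ⟨q.2.1.comp (contDiff_const.add contDiff_id), fun k => ?_⟩
    obtain ⟨f, hf, hfle⟩ := q.2.2 k
    obtain ⟨h, hh, hle⟩ := W.translate_le f hf |τ|
    refine ⟨h, hh, fun σ => ?_⟩
    rw [iteratedFDeriv_comp_add_left]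
    have h1 := hfle (τ + σ)
    have h2 := hle τ le_rfl σ
    rw [add_comm σ τ] at h2
    exact h1.trans h2⟩

/-- The velocity `q̇` of a trajectory. -/
def velocity (q : KinematicSpace W m) : KinematicSpace W m :=
  ⟨deriv q.1, by
    have hq : ContDiff ℝ ∞ q.1 := q.2.1
    refine ⟨(contDiff_infty_iff_deriv.1 hq).2, fun k => ?_⟩
    obtain ⟨f, hf, hfle⟩ := q.2.2 (k + 1)
    refine ⟨f, hf, fun σ => ?_⟩
    rw [norm_iteratedFDeriv_eq_norm_iteratedDeriv, ← iteratedDeriv_succ',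
      ← norm_iteratedFDeriv_eq_norm_iteratedDeriv]
    exact hfle σ⟩

/-! ### Regularizations of the Heaviside function -/

/-- A smooth step from `0` to `1`: a regularization of the Heaviside function. -/
structure SmoothStep where
  toFun : ℝ → ℝ
  smooth : ContDiff ℝ ∞ toFun
  mem_Icc : ∀ σ, toFun σ ∈ Set.Icc (0 : ℝ) 1
  eventually_const : ∃ R : ℝ, (∀ σ ≤ -R, toFun σ = 0) ∧ ∀ σ, R ≤ σ → toFun σ = 1

instance : CoeFun SmoothStep fun _ => ℝ → ℝ := ⟨SmoothStep.toFun⟩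

/-- The limit in which a smooth step tends to the Heaviside function: the width of the
transition interval around `0` shrinks to zero. -/
def heavisideLimit : Filter SmoothStep :=
  ⨅ ε : Set.Ioi (0 : ℝ),
    𝓟 {χ : SmoothStep | (∀ σ ≤ -(ε : ℝ), χ σ = 0) ∧ ∀ σ, (ε : ℝ) ≤ σ → χ σ = 1}

theorem SmoothStep.bounded_sub_const (χ : SmoothStep) (a : ℝ) (i : ℕ) :
    ∃ C : ℝ, ∀ σ, ‖iteratedFDeriv ℝ i (fun x => χ x - a) σ‖ ≤ C := by
  obtain ⟨R, hR0, hR1⟩ := χ.eventually_const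
  have hs : ContDiff ℝ ∞ (fun x => χ x - a) := χ.smooth.sub contDiff_const
  have hc : Continuous (iteratedFDeriv ℝ i (fun x => χ x - a)) :=
    hs.continuous_iteratedFDeriv (by exact_mod_cast le_top)
  obtain ⟨C, hC⟩ := (isCompact_Icc (a := -R) (b := R)).exists_bound_of_continuousOn
    hc.continuousOn
  have hconst : ∀ (b σ : ℝ), ‖iteratedFDeriv ℝ i (fun _ : ℝ => b) σ‖ ≤ |b| := by
    intro b σ
    rcases Nat.eq_zero_or_pos i with rfl | hi
    · simp
    · rw [iteratedFDeriv_const_of_ne hi.ne']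
      simp
  refine ⟨max C (max |0 - a| |1 - a|), fun σ => ?_⟩
  rcases lt_or_ge σ (-R) with h | h
  · have he : Filter.EventuallyEq (𝓝 σ) (fun x => χ x - a) (fun _ => 0 - a) := by
      filter_upwards [Iio_mem_nhds h] with x hx
      rw [hR0 x (le_of_lt hx)]
    rw [(Filter.EventuallyEq.iteratedFDeriv ℝ he i).eq_of_nhds]
    exact (hconst _ _).trans ((le_max_left _ _).trans (le_max_right _ _))
  · rcases lt_or_ge R σ with h' | h'
    · have he : Filter.EventuallyEq (𝓝 σ) (fun x => χ x - a) (fun _ => 1 - a) := by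
        filter_upwards [Ioi_mem_nhds h'] with x hx
        rw [hR1 x (le_of_lt hx)]
      rw [(Filter.EventuallyEq.iteratedFDeriv ℝ he i).eq_of_nhds]
      exact (hconst _ _).trans ((le_max_right _ _).trans (le_max_right _ _))
    · exact (hC σ ⟨h, h'⟩).trans (le_max_left _ _)

/-- The trajectory `σ ↦ (χ(σ) - a) η(σ)`. -/
def stepMul (χ : SmoothStep) (a : ℝ) (η : KinematicSpace W m) : KinematicSpace W m :=
  ⟨fun σ => (χ σ - a) • η.1 σ, by
    have hs : ContDiff ℝ ∞ (fun x => χ x - a) := χ.smooth.sub contDiff_const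
    have hη : ContDiff ℝ ∞ η.1 := η.2.1
    refine ⟨hs.smul hη, fun k => ?_⟩
    choose C hC using χ.bounded_sub_const a
    choose f hf hfle using η.2.2
    have hb : ∀ i : ℕ, ∃ h ∈ W.bounds, ∀ σ, ((k.choose i : ℝ) * |C i|) * f (k - i) σ ≤ h σ :=
      fun i => W.mul_le _ (hf (k - i))
    choose F hF hFle using hb
    obtain ⟨h, hh, hle⟩ := W.sum_le (k + 1) F hF
    refine ⟨h, hh, fun σ => ?_⟩
    refine (norm_iteratedFDeriv_smul_le hs hη σ (n := k) (by exact_mod_cast le_top)).trans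
      (le_trans (Finset.sum_le_sum fun i _ => ?_) (hle σ))
    refine le_trans ?_ (hFle i σ)
    have h1 : ‖iteratedFDeriv ℝ i (fun x => χ x - a) σ‖ ≤ |C i| := (hC i σ).trans (le_abs_self _)
    have h2 := hfle (k - i) σ
    gcongr⟩

/-! ### Smooth families and smooth functionals -/

/-- A family of trajectories depending smoothly on a parameter, with growth locally uniform in
the parameter. -/
def IsSmoothFamily {E : Type} [NormedAddCommGroup E] [NormedSpace ℝ E]
    (c : E → KinematicSpace W m) : Prop :=
  ContDiff ℝ ∞ (fun x : E × ℝ => (c x.1).1 x.2) ∧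
    ∀ (k : ℕ) (R : ℝ), ∃ f ∈ W.bounds, ∀ s : E, ‖s‖ ≤ R → ∀ σ : ℝ,
      ‖iteratedFDeriv ℝ k (fun x : E × ℝ => (c x.1).1 x.2) (s, σ)‖ ≤ f σ

/-- Smoothness of a functional on the extended kinematic space: it is smooth along every smooth
finite-dimensional family of points. -/
def IsSmoothLagrangian (L : KinematicSpace W m → ℝ → ℝ) : Prop :=
  ∀ (E : Type) [NormedAddCommGroup E] [NormedSpace ℝ E] [FiniteDimensional ℝ E]
    (c : E → KinematicSpace W m) (t : E → ℝ), IsSmoothFamily c → ContDiff ℝ ∞ t →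
      ContDiff ℝ ∞ fun s => L (c s) (t s)

/-! ### Functional derivatives and Lagrange equations

The functional derivative `Λ(q,t,τ,σ) = δ𝓛(T_τ q, t+τ)/δq(σ)` is in general a distribution in `σ`
(it contains Dirac deltas as soon as the Lagrangian has a local part), so it is represented by its
action on trajectories. -/

/-- `∫ Λ(q,t,τ,σ) η(σ) dσ`, the variation of `q ↦ 𝓛(T_τ q, t+τ)` in the direction `η`. -/
def Lam (L : KinematicSpace W m → ℝ → ℝ) (q : KinematicSpace W m) (t τ : ℝ)
    (η : KinematicSpace W m) : ℝ :=
  deriv (fun r : ℝ => L (shift τ (q + r • η)) (t + τ)) 0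

/-- `∫∫ δΛ(q,t,τ,σ)/δq(ρ) u(ρ) v(σ) dρ dσ`. -/
def dLam (L : KinematicSpace W m → ℝ → ℝ) (q : KinematicSpace W m) (t τ : ℝ)
    (u v : KinematicSpace W m) : ℝ :=
  deriv (fun r : ℝ => Lam L (q + r • u) t τ v) 0

/-- `∫ ∂_t Λ(q,t,τ,σ) η(σ) dσ`. -/
def dtLam (L : KinematicSpace W m → ℝ → ℝ) (q : KinematicSpace W m) (t τ : ℝ)
    (η : KinematicSpace W m) : ℝ :=
  deriv (fun r : ℝ => Lam L q (t + r) τ η) 0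

/-- The extended dynamic space `𝒟'`: the points with `Ψ(q,t,σ) = ∫ Λ(q,t,τ,σ) dτ = 0`, an equation
between distributions in `σ`. -/
def DynamicSpace (L : KinematicSpace W m → ℝ → ℝ) : Set (KinematicSpace W m × ℝ) :=
  {p | ∀ φ : KinematicSpace W m, HasCompactSupport φ.1 →
    Integrable (fun τ => Lam L p.1 p.2 τ φ) ∧ ∫ τ, Lam L p.1 p.2 τ φ = 0}

/-- Convergence of the integrals over `τ` that contain a (regularized) step: absolutely, locally
uniformly along smooth curves, and together with the derivative along the curve. -/
def IsSummableLagrangian (L : KinematicSpace W m → ℝ → ℝ) : Prop :=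
  ∀ (q η : ℝ → KinematicSpace W m) (t : ℝ → ℝ),
    IsSmoothFamily q → IsSmoothFamily η → ContDiff ℝ ∞ t → ∀ χ : SmoothStep,
      ∃ g : ℝ → ℝ, Integrable g ∧ ∀ s ∈ Set.Icc (-1 : ℝ) 1, ∀ τ : ℝ,
        |Lam L (q s) (t s) τ (stepMul χ (χ τ) (η s))| ≤ g τ ∧
        |deriv (fun s' => Lam L (q s') (t s') τ (stepMul χ (χ τ) (η s'))) s| ≤ g τ

/-! ### The extended phase space

Momenta are covectors on the kinematic space, `π η = ∫ π(σ) η(σ) dσ`; they may be distributions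
(for a first-order local Lagrangian, `P(q,t)(σ) = p δ(σ)`). Since the phase space is a vector
space, its tangent vectors `(δq, δπ, δt)` are again elements of it. -/

/-- The extended phase space, points `(q, π, t)`. -/
abbrev PhaseSpace (W : GrowthClass) (m : ℕ) : Type :=
  KinematicSpace W m × Module.Dual ℝ (KinematicSpace W m) × ℝ

/-- `H(q,π,t) = ∫ π(σ) q̇(σ) dσ - 𝓛(q,t)`. -/
def Ham (L : KinematicSpace W m → ℝ → ℝ) (x : PhaseSpace W m) : ℝ :=
  x.2.1 (velocity x.1) - L x.1 x.2.2

/-- The differential `δH` at `x`. -/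
def dHam (L : KinematicSpace W m → ℝ → ℝ) (x V : PhaseSpace W m) : ℝ :=
  deriv (fun r : ℝ => Ham L (x + r • V)) 0

/-- `Ω = ∫ δπ(σ) ∧ δq(σ) dσ`. -/
def Omega (V Z : PhaseSpace W m) : ℝ := V.2.1 Z.1 - Z.2.1 V.1

/-- The contact form `Ω' = Ω - δH ∧ δt` at `x`. -/
def OmegaPrime (L : KinematicSpace W m → ℝ → ℝ) (x V Z : PhaseSpace W m) : ℝ :=
  Omega V Z - (dHam L x V * Z.2.2 - dHam L x Z * V.2.2)

/-! ### The injection `j` -/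

/-- `∫∫ [χ(σ) - χ(τ)] Λ(q,t,τ,σ) η(σ) dσ dτ`, for a regularized step `χ`. -/
def regMomentum (L : KinematicSpace W m → ℝ → ℝ) (p : KinematicSpace W m × ℝ) (χ : SmoothStep)
    (η : KinematicSpace W m) : ℝ :=
  ∫ τ, Lam L p.1 p.2 τ (stepMul χ (χ τ) η)

/-- `π` is the momentum `P(q,t)(σ) = ∫ [θ(σ) - θ(τ)] Λ(q,t,τ,σ) dτ`, the product of distributions
being the limit over regularizations of the Heaviside function `θ`. -/
def IsMomentum (L : KinematicSpace W m → ℝ → ℝ) (p : KinematicSpace W m × ℝ)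
    (π : Module.Dual ℝ (KinematicSpace W m)) : Prop :=
  ∀ η, Tendsto (fun χ => regMomentum L p χ η) heavisideLimit (𝓝 (π η))

open Classical in
/-- The momentum `P(q,t)` (zero where it does not exist). -/
def momentum (L : KinematicSpace W m → ℝ → ℝ) (p : KinematicSpace W m × ℝ) :
    Module.Dual ℝ (KinematicSpace W m) :=
  if h : ∃ π, IsMomentum L p π then h.choose else 0

/-- The injection `j(q,t) = (q, P(q,t), t)`. -/
def inj (L : KinematicSpace W m → ℝ → ℝ) (p : KinematicSpace W m × ℝ) : PhaseSpace W m :=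
  (p.1, momentum L p, p.2)

/-- The reduced Hamiltonian `h = H ∘ j`. -/
def redHam (L : KinematicSpace W m → ℝ → ℝ) (p : KinematicSpace W m × ℝ) : ℝ := Ham L (inj L p)

/-! ### Differential calculus on the dynamic space -/

/-- `c` is a smooth curve in `𝒟'` through `p` (at parameter `0`) with velocity `V = (δq, δt)`. -/
structure IsCurve (L : KinematicSpace W m → ℝ → ℝ) (c : ℝ → KinematicSpace W m × ℝ)
    (p V : KinematicSpace W m × ℝ) : Prop where
  smooth_fst : IsSmoothFamily fun s => (c s).1
  smooth_snd : ContDiff ℝ ∞ fun s => (c s).2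
  mem : ∀ s, c s ∈ DynamicSpace L
  base : c 0 = p
  velocity_fst : ∀ σ, HasDerivAt (fun s => (c s).1.1 σ) (V.1.1 σ) 0
  velocity_snd : HasDerivAt (fun s => (c s).2) V.2 0

/-- The tangent vectors to `𝒟'` at `p`. -/
def TangentSet (L : KinematicSpace W m → ℝ → ℝ) (p : KinematicSpace W m × ℝ) :
    Set (KinematicSpace W m × ℝ) :=
  {V | ∃ c, IsCurve L c p V}

/-- `y` is the value at `V` of the differential at `p` of the function `F` on `𝒟'`. -/
def HasDifferential (L : KinematicSpace W m → ℝ → ℝ) (F : KinematicSpace W m × ℝ → ℝ)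
    (p V : KinematicSpace W m × ℝ) (y : ℝ) : Prop :=
  ∀ c, IsCurve L c p V → HasDerivAt (fun s => F (c s)) y 0

open Classical in
/-- The differential of a function on `𝒟'` (zero where it does not exist). -/
def differential (L : KinematicSpace W m → ℝ → ℝ) (F : KinematicSpace W m × ℝ → ℝ)
    (p V : KinematicSpace W m × ℝ) : ℝ :=
  if h : ∃ y, HasDifferential L F p V y then h.choose else 0

/-- `Z` is the image `j^T V` of the tangent vector `V` at `p`: the velocity of `j ∘ c` for every
curve `c` in `𝒟'` with velocity `V`. -/
def IsPushforward (L : KinematicSpace W m → ℝ → ℝ) (p V : KinematicSpace W m × ℝ)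
    (Z : PhaseSpace W m) : Prop :=
  ∀ c, IsCurve L c p V →
    (∀ σ, HasDerivAt (fun s => (inj L (c s)).1.1 σ) (Z.1.1 σ) 0) ∧
    (∀ η, HasDerivAt (fun s => (inj L (c s)).2.1 η) (Z.2.1 η) 0) ∧
    HasDerivAt (fun s => (inj L (c s)).2.2) Z.2.2 0

open Classical in
/-- The tangent map `j^T` (zero where it does not exist). -/
def pushforward (L : KinematicSpace W m → ℝ → ℝ) (p V : KinematicSpace W m × ℝ) :
    PhaseSpace W m :=
  if h : ∃ Z, IsPushforward L p V Z then h.choose else 0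

/-- `ω = j^* Ω = ∫ δP(q,t)(σ) ∧ δq(σ) dσ`. -/
def omega (L : KinematicSpace W m → ℝ → ℝ) (p V Z : KinematicSpace W m × ℝ) : ℝ :=
  Omega (pushforward L p V) (pushforward L p Z)

/-- `ω' = j^* Ω'`. -/
def omegaPrime (L : KinematicSpace W m → ℝ → ℝ) (p V Z : KinematicSpace W m × ℝ) : ℝ :=
  OmegaPrime L (inj L p) (pushforward L p V) (pushforward L p Z)

/-- The generator `X = ∂_t + ∫ q̇(σ) δ/δq(σ) dσ` of time evolution. -/
def generator (p : KinematicSpace W m × ℝ) : KinematicSpace W m × ℝ := (velocity p.1, 1)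

/-- Time evolution `(q, t) ↦ (T_ε q, t + ε)`. -/
def evolution (p : KinematicSpace W m × ℝ) (ε : ℝ) : KinematicSpace W m × ℝ :=
  (shift ε p.1, p.2 + ε)

/-! ### The explicit formula for the symplectic form, with a regularized step -/

/-- `∫∫ δΛ(q,t,τ,σ)/δq(ρ) [χ(σ) - χ(ρ)] u(ρ) v(σ) dρ dσ`. -/
def stepPairing (L : KinematicSpace W m → ℝ → ℝ) (p : KinematicSpace W m × ℝ) (τ : ℝ)
    (χ : SmoothStep) (u v : KinematicSpace W m) : ℝ :=
  dLam L p.1 p.2 τ u (stepMul χ 0 v) - dLam L p.1 p.2 τ (stepMul χ 0 u) v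

/-- `½ ∫∫∫ δΛ(q,t,τ,σ)/δq(ρ) [χ(σ) - χ(ρ)] δq(ρ) ∧ δq(σ)` evaluated on `V` and `Z`. -/
def regOmega (L : KinematicSpace W m → ℝ → ℝ) (p : KinematicSpace W m × ℝ) (χ : SmoothStep)
    (V Z : KinematicSpace W m × ℝ) : ℝ :=
  (1 / 2) * ∫ τ, (stepPairing L p τ χ V.1 Z.1 - stepPairing L p τ χ Z.1 V.1)

/-- `∫∫ [χ(σ) - χ(τ)] ∂_t Λ(q,t,τ,σ) δt ∧ δq(σ)` evaluated on `V` and `Z`. -/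
def regTimeTerm (L : KinematicSpace W m → ℝ → ℝ) (p : KinematicSpace W m × ℝ) (χ : SmoothStep)
    (V Z : KinematicSpace W m × ℝ) : ℝ :=
  ∫ τ, dtLam L p.1 p.2 τ (stepMul χ (χ τ) (V.2 • Z.1 - Z.2 • V.1))

end NonlocalMechanics

end

/-! The momentum is defined as a limit over steps `χ`, yet on `𝒟'` it has an exact expression at
each fixed `χ`. For two steps, `(χ - χ')η` has compact support, so the equation `Ψ = 0` kills its
pairing with `∫ Λ dτ`. Hence changing the step changes `∫∫ [χ(σ) - χ(τ)] Λ η` only through the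
coefficient `χ(τ)`. It follows that `regMomentum χ + stepError χ` does not depend on `χ`, where
`stepError χ = ∫ (χ(τ) - θ(τ)) (Λ η) dτ` involves only a shrinking interval of `τ` and tends to zero
(`regMomentum_add_stepError`, `momentum_eq`). No limit then has to be interchanged with a derivative
or an integral.

Differentiability: the exact expression is differentiated under the integral along a curve in `𝒟'`.
Summability supplies the majorant, and the transition term is an integral over a compact interval
(`IsCurve.hasDerivAt_momentum`). Functionals are smooth only along finite-dimensional families.
Hadamard's lemma, `c s = c 0 + s • w s` with `w` again a smooth family, therefore replaces Fréchet
calculus: it shows that derivatives depend only on the velocity `w 0`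
(`IsSmoothLagrangian.hasDerivAt_comp`). The same computation gives `δh = j^* δH`, hence `ω' = ω - δh
∧ δt`.

Formula for `ω`: the second variation of `𝓛` is symmetric, so in the antisymmetrized expression the
coefficient `χ(τ)` cancels and may be traded for `χ(ρ)`. At fixed `χ` the regularized formula
differs from `ω` only by two step errors (`regOmega_add_regTimeTerm`).

Degeneracy: translating `σ` and `τ` together also translates the step. The exact expression at the
evolved point thus differs from the one at `p` by `∫₀^ε Λ dτ` (`momentum_evolution`).
Differentiation gives Hamilton's equation `(δ_X P)(η) + P(η̇) = (δ𝓛/δq)(η)`, and in particular `δ_X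
h = -∂_t 𝓛`. With these, every term of `i_X ω'` cancels. -/

namespace NonlocalMechanics

/-! ### Integrals depending smoothly on a parameter -/

section ParametricIntegral

variable {X : Type} [NormedAddCommGroup X] [NormedSpace ℝ X]

theorem contDiff_fderiv_of_uncurry {F : Type} [NormedAddCommGroup F] [NormedSpace ℝ F]
    {g : ℝ → X → F} (hg : ContDiff ℝ ∞ (Function.uncurry g)) :
    ContDiff ℝ ∞ (Function.uncurry fun u x => fderiv ℝ (g u) x) := by
  have h : ContDiff ℝ ∞ (Function.uncurry fun y : ℝ × X => g y.1) := by
    have : (Function.uncurry fun y : ℝ × X => g y.1) =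
        Function.uncurry g ∘ fun z : (ℝ × X) × X => (z.1.1, z.2) := by
      ext z; rfl
    rw [this]
    exact hg.comp (by fun_prop)
  exact ContDiff.fderiv h contDiff_snd (by simp)

variable [FiniteDimensional ℝ X]

theorem hasFDerivAt_intervalIntegral_of_contDiff {F : Type} [NormedAddCommGroup F]
    [NormedSpace ℝ F] {g : ℝ → X → F} (hg : ContDiff ℝ ∞ (Function.uncurry g)) (x : X) :
    HasFDerivAt (fun y => ∫ u in (0 : ℝ)..1, g u y) (∫ u in (0 : ℝ)..1, fderiv ℝ (g u) x) x := by
  have hg' := (contDiff_fderiv_of_uncurry hg).continuous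
  have hgu : ∀ u, ContDiff ℝ ∞ (g u) := fun u =>
    hg.comp (contDiff_const.prodMk contDiff_id : ContDiff ℝ ∞ fun y : X => (u, y))
  have hgx : ∀ y, Continuous fun u => g u y := fun y =>
    hg.continuous.comp (Continuous.prodMk continuous_id continuous_const)
  have hgx' : ∀ y, Continuous fun u => fderiv ℝ (g u) y := fun y =>
    hg'.comp (Continuous.prodMk continuous_id continuous_const)
  obtain ⟨C, hC⟩ := ((isCompact_Icc (a := (0 : ℝ)) (b := 1)).prod
    (isCompact_closedBall x 1)).exists_bound_of_continuousOn hg'.continuousOn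
  refine intervalIntegral.hasFDerivAt_integral_of_dominated_of_fderiv_le
    (F' := fun y u => fderiv ℝ (g u) y) (bound := fun _ => C)
    (Metric.closedBall_mem_nhds x one_pos)
    (Eventually.of_forall fun y => (hgx y).aestronglyMeasurable)
    ((hgx x).intervalIntegrable _ _) (hgx' x).aestronglyMeasurable
    (ae_of_all _ fun u hu y hy => ?_) (by simp) (ae_of_all _ fun u _ y _ => ?_)
  · rw [Set.uIoc_of_le zero_le_one] at hu
    exact hC (u, y) ⟨⟨hu.1.le, hu.2⟩, hy⟩
  · exact ((hgu u).differentiable (by simp) y).hasFDerivAt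

/-- The derivative of the average over `u` is the average of the derivatives, so a bound uniform in
`u` passes to the integral with the same constant. The target space is quantified after `n` because
the induction step replaces `g` by its derivative, whose values are linear maps. -/
theorem contDiff_nat_intervalIntegral (n : ℕ) :
    ∀ {F : Type} [NormedAddCommGroup F] [NormedSpace ℝ F] {g : ℝ → X → F},
      ContDiff ℝ ∞ (Function.uncurry g) →
      ContDiff ℝ n (fun y => ∫ u in (0 : ℝ)..1, g u y) ∧
      ∀ (x : X) (C : ℝ), (∀ u ∈ Set.Icc (0 : ℝ) 1, ‖iteratedFDeriv ℝ n (g u) x‖ ≤ C) →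
        ‖iteratedFDeriv ℝ n (fun y => ∫ u in (0 : ℝ)..1, g u y) x‖ ≤ C := by
  induction n with
  | zero =>
    intro F _ _ g hg
    constructor
    · rw [Nat.cast_zero, contDiff_zero]
      exact continuous_iff_continuousAt.2 fun x =>
        (hasFDerivAt_intervalIntegral_of_contDiff hg x).continuousAt
    · intro x C hC
      simp only [norm_iteratedFDeriv_zero] at hC ⊢
      have := intervalIntegral.norm_integral_le_of_norm_le_const (a := (0 : ℝ)) (b := 1)
        (f := fun u => g u x) (C := C) fun u hu => by
          rw [Set.uIoc_of_le zero_le_one] at hu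
          exact hC u ⟨hu.1.le, hu.2⟩
      simpa using this
  | succ n ih =>
    intro F _ _ g hg
    have hfd : fderiv ℝ (fun y => ∫ u in (0 : ℝ)..1, g u y) =
        fun x => ∫ u in (0 : ℝ)..1, fderiv ℝ (g u) x :=
      funext fun x => (hasFDerivAt_intervalIntegral_of_contDiff hg x).fderiv
    obtain ⟨h1, h2⟩ := ih (contDiff_fderiv_of_uncurry hg)
    constructor
    · rw [Nat.cast_succ, contDiff_succ_iff_fderiv, hfd]
      exact ⟨fun x => (hasFDerivAt_intervalIntegral_of_contDiff hg x).differentiableAt,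
        by simp, h1⟩
    · intro x C hC
      rw [← norm_iteratedFDeriv_fderiv, hfd]
      refine h2 x C fun u hu => ?_
      rw [norm_iteratedFDeriv_fderiv]
      exact hC u hu

end ParametricIntegral

/-! ### Operations on smooth families -/

section Families

variable {W : GrowthClass} {m : ℕ}
  {E : Type} [NormedAddCommGroup E] [NormedSpace ℝ E]
  {E' : Type} [NormedAddCommGroup E'] [NormedSpace ℝ E']

theorem norm_iteratedFDeriv_comp_clm_le {X Y F : Type} [NormedAddCommGroup X] [NormedSpace ℝ X]
    [NormedAddCommGroup Y] [NormedSpace ℝ Y] [NormedAddCommGroup F] [NormedSpace ℝ F]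
    {f : Y → F} (hf : ContDiff ℝ ∞ f) (A : X →L[ℝ] Y) (k : ℕ) (x : X) :
    ‖iteratedFDeriv ℝ k (f ∘ A) x‖ ≤ ‖A‖ ^ k * ‖iteratedFDeriv ℝ k f (A x)‖ := by
  rw [A.iteratedFDeriv_comp_right hf x (by exact_mod_cast le_top), mul_comm]
  refine (ContinuousMultilinearMap.norm_compContinuousLinearMap_le _ _).trans_eq ?_
  simp

/-- The derivatives of `f : E × ℝ → F` are bounded by the growth class, locally uniformly in the
first variable. -/
def HasGrowth (W : GrowthClass) {F : Type} [NormedAddCommGroup F] [NormedSpace ℝ F]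
    (f : E × ℝ → F) : Prop :=
  ∀ (k : ℕ) (R : ℝ), ∃ b ∈ W.bounds, ∀ s : E, ‖s‖ ≤ R → ∀ σ : ℝ,
    ‖iteratedFDeriv ℝ k f (s, σ)‖ ≤ b σ

/-- On the joint variable this is precomposition with the linear map `(s, σ) ↦ (B s, l s + σ)`. The
translation `l s` is bounded for bounded `s`, so `translate_le` absorbs it. -/
theorem IsSmoothFamily.shift_comp {c : E → KinematicSpace W m} (hc : IsSmoothFamily c)
    (B : E' →L[ℝ] E) (l : E' →L[ℝ] ℝ) : IsSmoothFamily fun s => shift (l s) (c (B s)) := by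
  let A : E' × ℝ →L[ℝ] E × ℝ := (B.comp (.fst ℝ E' ℝ)).prod (l.comp (.fst ℝ E' ℝ) + .snd ℝ E' ℝ)
  have hA : (fun x : E' × ℝ => (shift (l x.1) (c (B x.1))).1 x.2) =
      (fun x : E × ℝ => (c x.1).1 x.2) ∘ A := by
    ext x : 1
    rfl
  rw [IsSmoothFamily, hA]
  refine ⟨hc.1.comp A.contDiff, fun k R => ?_⟩
  obtain ⟨f, hf, hle⟩ := hc.2 k (‖B‖ * R)
  obtain ⟨g, hg, hgle⟩ := W.translate_le f hf (‖l‖ * R)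
  obtain ⟨h, hh, hhle⟩ := W.mul_le (‖A‖ ^ k) hg
  refine ⟨h, hh, fun s hs σ => ?_⟩
  refine (norm_iteratedFDeriv_comp_clm_le hc.1 A k _).trans (le_trans ?_ (hhle σ))
  refine mul_le_mul_of_nonneg_left ?_ (by positivity)
  have h1 := hle (B s) ((B.le_opNorm s).trans (by gcongr)) (l s + σ)
  have h2 := hgle (l s) ((l.le_opNorm s).trans (by gcongr)) σ
  rw [add_comm] at h2
  exact h1.trans h2

theorem shift_zero (q : KinematicSpace W m) : shift 0 q = q :=
  Subtype.ext (funext fun σ => congrArg q.1 (zero_add σ))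

theorem IsSmoothFamily.comp_clm {c : E → KinematicSpace W m} (hc : IsSmoothFamily c)
    (B : E' →L[ℝ] E) : IsSmoothFamily fun s => c (B s) := by
  simpa [shift_zero] using hc.shift_comp B 0

theorem isSmoothFamily_const (q : KinematicSpace W m) :
    IsSmoothFamily fun _ : E => q := by
  have hA : (fun x : E × ℝ => q.1 x.2) = q.1 ∘ ContinuousLinearMap.snd ℝ E ℝ := rfl
  rw [IsSmoothFamily, hA]
  refine ⟨q.2.1.comp (ContinuousLinearMap.contDiff _), fun k R => ?_⟩
  obtain ⟨f, hf, hle⟩ := q.2.2 k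
  obtain ⟨h, hh, hhle⟩ := W.mul_le (‖ContinuousLinearMap.snd ℝ E ℝ‖ ^ k) hf
  refine ⟨h, hh, fun s _ σ => ?_⟩
  exact (norm_iteratedFDeriv_comp_clm_le q.2.1 _ k _).trans
    ((mul_le_mul_of_nonneg_left (hle σ) (by positivity)).trans (hhle σ))

theorem IsSmoothFamily.add {c d : E → KinematicSpace W m} (hc : IsSmoothFamily c)
    (hd : IsSmoothFamily d) : IsSmoothFamily fun s => c s + d s := by
  refine ⟨hc.1.add hd.1, fun k R => ?_⟩
  obtain ⟨f, hf, hfle⟩ := hc.2 k R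
  obtain ⟨g, hg, hgle⟩ := hd.2 k R
  obtain ⟨h, hh, hle⟩ := W.add_le f hf g hg
  refine ⟨h, hh, fun s hs σ => ?_⟩
  have : (fun x : E × ℝ => (c x.1 + d x.1).1 x.2) =
    (fun x : E × ℝ => (c x.1).1 x.2) + fun x : E × ℝ => (d x.1).1 x.2 := rfl
  rw [this, iteratedFDeriv_add (hc.1.of_le (by exact_mod_cast le_top))
      (hd.1.of_le (by exact_mod_cast le_top))]
  exact (norm_add_le _ _).trans ((add_le_add (hfle s hs σ) (hgle s hs σ)).trans (hle σ))

/-- Multiplication of the values by a scalar function with locally uniformly bounded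
derivatives preserves growth. -/
theorem HasGrowth.smul {F : Type} [NormedAddCommGroup F] [NormedSpace ℝ F] {f : E × ℝ → F}
    (hf : ContDiff ℝ ∞ f) (hfW : HasGrowth W f) {a : E × ℝ → ℝ} (ha : ContDiff ℝ ∞ a)
    (hab : ∀ (k : ℕ) (R : ℝ), ∃ C, ∀ s : E, ‖s‖ ≤ R → ∀ σ : ℝ,
      ‖iteratedFDeriv ℝ k a (s, σ)‖ ≤ C) :
    HasGrowth W fun x => a x • f x := by
  intro k R
  choose C hC using fun i => hab i R
  choose g hg hgle using fun i => hfW i R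
  have hb : ∀ i : ℕ, ∃ h ∈ W.bounds, ∀ σ, ((k.choose i : ℝ) * |C i|) * g (k - i) σ ≤ h σ :=
    fun i => W.mul_le _ (hg (k - i))
  choose G hG hGle using hb
  obtain ⟨h, hh, hle⟩ := W.sum_le (k + 1) G hG
  refine ⟨h, hh, fun s hs σ => ?_⟩
  refine (norm_iteratedFDeriv_smul_le ha hf _ (n := k) (by exact_mod_cast le_top)).trans
    (le_trans (Finset.sum_le_sum fun i _ => ?_) (hle σ))
  refine le_trans ?_ (hGle i σ)
  have h1 : ‖iteratedFDeriv ℝ i a (s, σ)‖ ≤ |C i| := (hC i s hs σ).trans (le_abs_self _)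
  have h2 := hgle (k - i) s hs σ
  gcongr

theorem IsSmoothFamily.smul [FiniteDimensional ℝ E] {c : E → KinematicSpace W m}
    (hc : IsSmoothFamily c) {a : E → ℝ} (ha : ContDiff ℝ ∞ a) :
    IsSmoothFamily fun s => a s • c s := by
  have ha' : ContDiff ℝ ∞ (fun x : E × ℝ => a x.1) := ha.comp contDiff_fst
  refine ⟨ha'.smul hc.1, HasGrowth.smul hc.1 hc.2 ha' fun k R => ?_⟩
  -- Closed balls of `E` are compact in finite dimension, which bounds the derivatives of `a`
  -- locally uniformly.
  have hcont : Continuous (iteratedFDeriv ℝ k a) :=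
    ha.continuous_iteratedFDeriv (by exact_mod_cast le_top)
  obtain ⟨C, hC⟩ := (isCompact_closedBall (0 : E) R).exists_bound_of_continuousOn
    hcont.continuousOn
  refine ⟨‖ContinuousLinearMap.fst ℝ E ℝ‖ ^ k * C, fun s hs σ => ?_⟩
  exact (norm_iteratedFDeriv_comp_clm_le ha (ContinuousLinearMap.fst ℝ E ℝ) k _).trans
    (mul_le_mul_of_nonneg_left (hC s (by simpa using hs)) (by positivity))

/-- The constant `a`, later `χ(τ)`, is split off as a scalar coefficient, so that its dependence on
`τ` leaves the trajectory. -/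
theorem stepMul_eq (χ : SmoothStep) (a : ℝ) (η : KinematicSpace W m) :
    stepMul χ a η = stepMul χ 0 η + (-a) • η := by
  refine Subtype.ext (funext fun σ => ?_)
  change (χ σ - a) • η.1 σ = (χ σ - 0) • η.1 σ + (-a) • η.1 σ
  module

theorem IsSmoothFamily.stepMul {c : E → KinematicSpace W m}
    (hc : IsSmoothFamily c) (χ : SmoothStep) :
    IsSmoothFamily fun s => stepMul χ 0 (c s) := by
  have hχ : ContDiff ℝ ∞ (fun x => χ x - 0) := χ.smooth.sub contDiff_const
  have ha' : ContDiff ℝ ∞ (fun x : E × ℝ => χ x.2 - 0) := hχ.comp contDiff_snd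
  refine ⟨ha'.smul hc.1, HasGrowth.smul hc.1 hc.2 ha' fun k R => ?_⟩
  obtain ⟨C, hC⟩ := χ.bounded_sub_const 0 k
  refine ⟨‖ContinuousLinearMap.snd ℝ E ℝ‖ ^ k * C, fun s hs σ => ?_⟩
  exact (norm_iteratedFDeriv_comp_clm_le hχ (ContinuousLinearMap.snd ℝ E ℝ) k _).trans
    (mul_le_mul_of_nonneg_left (hC σ) (by positivity))

theorem HasGrowth.fderiv_apply {F : Type} [NormedAddCommGroup F] [NormedSpace ℝ F]
    {f : E × ℝ → F} (hf : ContDiff ℝ ∞ f) (hfW : HasGrowth W f) (w : E × ℝ) :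
    HasGrowth W fun x => fderiv ℝ f x w := by
  intro k R
  obtain ⟨g, hg, hgle⟩ := hfW (k + 1) R
  obtain ⟨h, hh, hle⟩ := W.mul_le ‖w‖ hg
  refine ⟨h, hh, fun s hs σ => ?_⟩
  refine (norm_iteratedFDeriv_clm_apply_const (N := ∞)
    (hf.fderiv_right (by simp)).contDiffAt (by exact_mod_cast le_top)).trans ?_
  rw [norm_iteratedFDeriv_fderiv]
  exact (mul_le_mul_of_nonneg_left (hgle s hs σ) (norm_nonneg w)).trans (hle σ)

theorem contDiff_fderiv_apply_const {X F : Type} [NormedAddCommGroup X] [NormedSpace ℝ X]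
    [NormedAddCommGroup F] [NormedSpace ℝ F] {f : X → F} (hf : ContDiff ℝ ∞ f) (w : X) :
    ContDiff ℝ ∞ fun x => fderiv ℝ f x w :=
  (hf.fderiv_right (by simp)).clm_apply contDiff_const

theorem IsSmoothFamily.velocity {c : E → KinematicSpace W m} (hc : IsSmoothFamily c) :
    IsSmoothFamily fun s => velocity (c s) := by
  have h : (fun x : E × ℝ => (NonlocalMechanics.velocity (c x.1)).1 x.2) =
      fun x => fderiv ℝ (fun x : E × ℝ => (c x.1).1 x.2) x (0, 1) := by
    ext x : 1
    have h1 : HasDerivAt (fun σ : ℝ => (x.1, σ)) ((0 : E), (1 : ℝ)) x.2 :=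
      (hasDerivAt_const _ _).prodMk (hasDerivAt_id _)
    exact (((hc.1.differentiable (by simp) x).hasFDerivAt).comp_hasDerivAt x.2 h1).deriv
  rw [IsSmoothFamily, h]
  exact ⟨contDiff_fderiv_apply_const hc.1 _, HasGrowth.fderiv_apply hc.1 hc.2 _⟩

theorem mem_kinematicSpace_of_family {f : E × ℝ → Fin m → ℝ} (hf : ContDiff ℝ ∞ f)
    (hfW : HasGrowth W f) (s : E) : (fun σ => f (s, σ)) ∈ KinematicSpace W m := by
  -- The inclusion `σ ↦ (s, σ)` is only affine: it is written as a linear map followed by a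
  -- translation of `f`.
  have hA : (fun σ => f (s, σ)) =
      (fun z => f ((s, 0) + z)) ∘ ContinuousLinearMap.inr ℝ E ℝ := by
    ext σ : 1
    simp
  have hf' : ContDiff ℝ ∞ (fun z => f ((s, 0) + z)) := hf.comp (by fun_prop)
  refine ⟨hf.comp (contDiff_const.prodMk contDiff_id), fun k => ?_⟩
  obtain ⟨g, hg, hgle⟩ := hfW k ‖s‖
  obtain ⟨h, hh, hle⟩ := W.mul_le (‖ContinuousLinearMap.inr ℝ E ℝ‖ ^ k) hg
  refine ⟨h, hh, fun σ => ?_⟩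
  rw [hA]
  refine (norm_iteratedFDeriv_comp_clm_le hf' _ k _).trans (le_trans ?_ (hle σ))
  rw [iteratedFDeriv_comp_add_left]
  refine mul_le_mul_of_nonneg_left ?_ (by positivity)
  simpa using hgle s le_rfl σ

/-- Hadamard's lemma for smooth curves of trajectories. -/
theorem IsSmoothFamily.exists_slope {c : ℝ → KinematicSpace W m} (hc : IsSmoothFamily c) :
    ∃ w : ℝ → KinematicSpace W m, IsSmoothFamily w ∧ ∀ s, c s = c 0 + s • w s := by
  let J : ℝ × ℝ → Fin m → ℝ := fun x => (c x.1).1 x.2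
  -- The slope will be `w s = ∫₀¹ f (u s, ·) du`, with `f` the derivative in the parameter. The maps
  -- `A u : (s, σ) ↦ (u s, σ)` fix `σ` and are contractions, so the majorant for `f` serves the
  -- average unchanged.
  let f : ℝ × ℝ → Fin m → ℝ := fun x => fderiv ℝ J x (1, 0)
  have hf : ContDiff ℝ ∞ f := contDiff_fderiv_apply_const hc.1 _
  have hfW : HasGrowth W f := HasGrowth.fderiv_apply hc.1 hc.2 _
  let A : ℝ → ℝ × ℝ →L[ℝ] ℝ × ℝ := fun u =>
    (u • ContinuousLinearMap.fst ℝ ℝ ℝ).prod (.snd ℝ ℝ ℝ)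
  have hA : ∀ u ∈ Set.Icc (0 : ℝ) 1, ‖A u‖ ≤ 1 := by
    intro u hu
    refine ContinuousLinearMap.opNorm_le_bound _ zero_le_one fun x => ?_
    rw [one_mul]
    refine norm_prod_le_iff.2 ⟨?_, norm_snd_le x⟩
    change ‖u * x.1‖ ≤ ‖x‖
    rw [norm_mul, Real.norm_of_nonneg hu.1]
    calc u * ‖x.1‖ ≤ 1 * ‖x.1‖ := by gcongr; exact hu.2
      _ ≤ ‖x‖ := by rw [one_mul]; exact norm_fst_le x
  let g : ℝ → ℝ × ℝ → Fin m → ℝ := fun u => f ∘ A u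
  have hg : ContDiff ℝ ∞ (Function.uncurry g) := by
    have : Function.uncurry g = f ∘ fun z : ℝ × ℝ × ℝ => (z.1 * z.2.1, z.2.2) := by
      ext z : 1; rfl
    rw [this]
    exact hf.comp (by fun_prop)
  let G : ℝ × ℝ → Fin m → ℝ := fun x => ∫ u in (0 : ℝ)..1, g u x
  have hG : ContDiff ℝ ∞ G := contDiff_infty.2 fun n => (contDiff_nat_intervalIntegral n hg).1
  have hGW : HasGrowth W G := by
    intro k R
    obtain ⟨b, hb, hle⟩ := hfW k R
    refine ⟨b, hb, fun s hs σ => (contDiff_nat_intervalIntegral k hg).2 _ _ fun u hu => ?_⟩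
    refine (norm_iteratedFDeriv_comp_clm_le hf (A u) k _).trans ?_
    have h1 : ‖A u‖ ^ k ≤ 1 := pow_le_one₀ (norm_nonneg _) (hA u hu)
    have h2 : ‖u * s‖ ≤ R := by
      rw [norm_mul, Real.norm_of_nonneg hu.1]
      exact (mul_le_of_le_one_left (norm_nonneg _) hu.2).trans hs
    exact (mul_le_of_le_one_left (norm_nonneg _) h1).trans (hle (u * s) h2 σ)
  refine ⟨fun s => ⟨_, mem_kinematicSpace_of_family hG hGW s⟩, ⟨hG, hGW⟩, fun s => ?_⟩
  refine Subtype.ext (funext fun σ => ?_)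
  change J (s, σ) = J (0, σ) + s • ∫ u in (0 : ℝ)..1, f (u * s, σ)
  have hd : ∀ u ∈ Set.uIcc (0 : ℝ) 1,
      HasDerivAt (fun u : ℝ => J (u * s, σ)) (s • f (u * s, σ)) u := by
    intro u _
    have h1 : HasDerivAt (fun u : ℝ => (u * s, σ)) (s • ((1 : ℝ), (0 : ℝ))) u := by
      have := ((hasDerivAt_id u).mul_const s).prodMk (hasDerivAt_const u σ)
      simpa using this
    have h2 := ((hc.1.differentiable (by simp) (u * s, σ)).hasFDerivAt).comp_hasDerivAt u h1
    rw [map_smul] at h2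
    exact h2
  have hint : IntervalIntegrable (fun u : ℝ => s • f (u * s, σ)) volume 0 1 := by
    refine Continuous.intervalIntegrable ?_ _ _
    exact (hf.continuous.comp
      (by fun_prop : Continuous fun u : ℝ => (u * s, σ))).const_smul s
  have := intervalIntegral.integral_eq_sub_of_hasDerivAt hd hint
  rw [intervalIntegral.integral_smul] at this
  rw [this]
  simp

theorem IsSmoothFamily.slope_zero {c w : ℝ → KinematicSpace W m}
    (hw : IsSmoothFamily w) (h : ∀ s, c s = c 0 + s • w s) (σ : ℝ) :
    HasDerivAt (fun s => (c s).1 σ) ((w 0).1 σ) 0 := by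
  have h1 : (fun s => (c s).1 σ) = fun s => (c 0).1 σ + s • (w s).1 σ := by
    ext s : 1
    rw [h s]; simp
  have h2 : ContDiff ℝ ∞ fun s => (w s).1 σ :=
    hw.1.comp (contDiff_id.prodMk contDiff_const : ContDiff ℝ ∞ fun s : ℝ => (s, σ))
  have h3 := ((hasDerivAt_id (0 : ℝ)).smul
    (h2.differentiable (by simp) 0).hasDerivAt).const_add ((c 0).1 σ)
  rw [h1]
  simpa using h3

end Families

/-! ### Calculus of smooth functionals -/

section Calculus

variable {W : GrowthClass} {m : ℕ}
  {E : Type} [NormedAddCommGroup E] [NormedSpace ℝ E] [FiniteDimensional ℝ E]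

/-- The variation of the functional `M` in the direction `u`. -/
noncomputable def dirDeriv (M : KinematicSpace W m → ℝ → ℝ) (q : KinematicSpace W m) (t : ℝ)
    (u : KinematicSpace W m) : ℝ :=
  deriv (fun r : ℝ => M (q + r • u) t) 0

/-- The explicit time derivative of the functional `M`. -/
noncomputable def timeDeriv (M : KinematicSpace W m → ℝ → ℝ) (q : KinematicSpace W m)
    (t : ℝ) : ℝ :=
  deriv (fun r : ℝ => M q (t + r)) 0

/-- Translates the one-parameter derivatives that define variations into Fréchet derivatives of a
functional restricted to a finite-dimensional family, where ordinary calculus applies. -/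
theorem deriv_line_zero {X : Type} [NormedAddCommGroup X] [NormedSpace ℝ X] {G : X → ℝ}
    (hG : ContDiff ℝ ∞ G) (x w : X) :
    deriv (fun r : ℝ => G (x + r • w)) 0 = fderiv ℝ G x w := by
  have h1 : HasDerivAt (fun r : ℝ => x + r • w) w 0 := by
    simpa using ((hasDerivAt_id (0 : ℝ)).smul_const w).const_add x
  have h2 : HasFDerivAt G (fderiv ℝ G x) (x + (0 : ℝ) • w) := by
    simpa using (hG.differentiable (by simp) x).hasFDerivAt
  exact (h2.comp_hasDerivAt (0 : ℝ) h1).deriv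

theorem contDiff_deriv_zero {X : Type} [NormedAddCommGroup X] [NormedSpace ℝ X]
    {G : X × ℝ → ℝ} (hG : ContDiff ℝ ∞ G) :
    ContDiff ℝ ∞ fun x : X => deriv (fun r : ℝ => G (x, r)) 0 := by
  have h : (fun x : X => deriv (fun r : ℝ => G (x, r)) 0) =
      fun x => fderiv ℝ G (x, 0) (0, 1) := by
    ext x
    rw [← deriv_line_zero hG]
    simp
  rw [h]
  exact (contDiff_fderiv_apply_const hG _).comp (by fun_prop : ContDiff ℝ ∞ fun x : X => (x, (0 : ℝ)))

/-- `τ` is treated as one more parameter of the family; this yields smoothness jointly in `(s, τ)`.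
-/
theorem IsSmoothLagrangian.contDiff_shift {L : KinematicSpace W m → ℝ → ℝ}
    (hL : IsSmoothLagrangian L) {q : E → KinematicSpace W m} {t : E → ℝ}
    (hq : IsSmoothFamily q) (ht : ContDiff ℝ ∞ t) :
    ContDiff ℝ ∞ fun x : E × ℝ => L (shift x.2 (q x.1)) (t x.1 + x.2) :=
  hL (E × ℝ) _ _ (hq.shift_comp (.fst ℝ E ℝ) (.snd ℝ E ℝ)) ((ht.comp contDiff_fst).add contDiff_snd)

theorem IsSmoothLagrangian.shifted {L : KinematicSpace W m → ℝ → ℝ}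
    (hL : IsSmoothLagrangian L) (τ : ℝ) :
    IsSmoothLagrangian fun (q : KinematicSpace W m) t => L (shift τ q) (t + τ) := by
  intro E _ _ _ c t hc ht
  exact (hL.contDiff_shift hc ht).comp (by fun_prop : ContDiff ℝ ∞ fun s : E => (s, τ))

theorem IsSmoothFamily.add_smul {q u : E → KinematicSpace W m} (hq : IsSmoothFamily q)
    (hu : IsSmoothFamily u) : IsSmoothFamily fun x : E × ℝ => q x.1 + x.2 • u x.1 :=
  (hq.comp_clm (.fst ℝ E ℝ)).add ((hu.comp_clm (.fst ℝ E ℝ)).smul contDiff_snd)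

theorem IsSmoothLagrangian.contDiff_lam {L : KinematicSpace W m → ℝ → ℝ}
    (hL : IsSmoothLagrangian L) {q η : E → KinematicSpace W m} {t : E → ℝ}
    (hq : IsSmoothFamily q) (hη : IsSmoothFamily η) (ht : ContDiff ℝ ∞ t) :
    ContDiff ℝ ∞ fun x : E × ℝ => Lam L (q x.1) (t x.1) x.2 (η x.1) := by
  have h := hL.contDiff_shift (hq.add_smul hη) (ht.comp contDiff_fst)
  exact contDiff_deriv_zero (G := fun y : (E × ℝ) × ℝ =>
      L (shift y.1.2 (q y.1.1 + y.2 • η y.1.1)) (t y.1.1 + y.1.2))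
    (h.comp (by fun_prop : ContDiff ℝ ∞ fun y : (E × ℝ) × ℝ => ((y.1.1, y.2), y.1.2)))

/-- A first variation is again a smooth functional, so the first-order results below apply to second
variations as well. -/
theorem IsSmoothLagrangian.lam {L : KinematicSpace W m → ℝ → ℝ}
    (hL : IsSmoothLagrangian L) (τ : ℝ) (η : KinematicSpace W m) :
    IsSmoothLagrangian fun q t => Lam L q t τ η := by
  intro E _ _ _ c t hc ht
  exact (hL.contDiff_lam hc (isSmoothFamily_const η) ht).comp
    (by fun_prop : ContDiff ℝ ∞ fun s : E => (s, τ))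

variable {M : KinematicSpace W m → ℝ → ℝ}

theorem IsSmoothLagrangian.contDiff_plane (hM : IsSmoothLagrangian M)
    (q : KinematicSpace W m) (t : ℝ) (u v : KinematicSpace W m) :
    ContDiff ℝ ∞ fun x : ℝ × ℝ => M (q + (x.1 • u + x.2 • v)) t :=
  hM (ℝ × ℝ) _ _ ((isSmoothFamily_const q).add
    (((isSmoothFamily_const u).smul contDiff_fst).add
      ((isSmoothFamily_const v).smul contDiff_snd))) contDiff_const

/-- Linearity is not automatic for directional derivatives. It holds because `M` restricted to the
plane `q + ℝ u + ℝ v` is an honest smooth function of two variables. -/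
theorem IsSmoothLagrangian.dirDeriv_add_smul (hM : IsSmoothLagrangian M)
    (q : KinematicSpace W m) (t : ℝ) (u v : KinematicSpace W m) (a b : ℝ) :
    dirDeriv M q t (a • u + b • v) = a * dirDeriv M q t u + b * dirDeriv M q t v := by
  have hG := hM.contDiff_plane q t u v
  set G : ℝ × ℝ → ℝ := fun x => M (q + (x.1 • u + x.2 • v)) t with hGdef
  have key : ∀ a b : ℝ, dirDeriv M q t (a • u + b • v) = fderiv ℝ G 0 (a, b) := by
    intro a b
    rw [← deriv_line_zero hG]
    refine congrArg (fun f => deriv f 0) (funext fun r => ?_)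
    simp only [hGdef, zero_add, Prod.smul_mk, smul_eq_mul]
    congr 1
    module
  have h1 := key 1 0
  have h2 := key 0 1
  simp only [one_smul, zero_smul, add_zero, zero_add] at h1 h2
  rw [key, h1, h2]
  have : ((a, b) : ℝ × ℝ) = a • ((1 : ℝ), (0 : ℝ)) + b • ((0 : ℝ), (1 : ℝ)) := by simp
  rw [this, map_add, map_smul, map_smul, smul_eq_mul, smul_eq_mul]

/-- Symmetry of the second derivative on the plane `q + ℝ u + ℝ v`. -/
theorem IsSmoothLagrangian.dirDeriv_comm (hM : IsSmoothLagrangian M)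
    (q : KinematicSpace W m) (t : ℝ) (u v : KinematicSpace W m) :
    dirDeriv (fun q t => dirDeriv M q t v) q t u =
      dirDeriv (fun q t => dirDeriv M q t u) q t v := by
  have key : ∀ u v : KinematicSpace W m, dirDeriv (fun q t => dirDeriv M q t v) q t u =
      fderiv ℝ (fun x => fderiv ℝ (fun x : ℝ × ℝ => M (q + (x.1 • u + x.2 • v)) t) x (0, 1)) 0
        (1, 0) := by
    intro u v
    have hG := hM.contDiff_plane q t u v
    rw [← deriv_line_zero (contDiff_fderiv_apply_const hG _)]
    refine congrArg (fun f => deriv f 0) (funext fun r => ?_)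
    rw [← deriv_line_zero hG]
    refine congrArg (fun f => deriv f 0) (funext fun r' => ?_)
    simp [add_assoc]
  rw [key u v]
  have hG := hM.contDiff_plane q t u v
  set G : ℝ × ℝ → ℝ := fun x => M (q + (x.1 • u + x.2 • v)) t with hGdef
  have hd : DifferentiableAt ℝ (fderiv ℝ G) 0 :=
    (hG.fderiv_right (m := ∞) (by simp)).differentiable (by simp) 0
  have happ : ∀ w z, fderiv ℝ (fun x => fderiv ℝ G x w) 0 z = fderiv ℝ (fderiv ℝ G) 0 z w := by
    intro w z
    have := (hd.hasFDerivAt.clm_apply (hasFDerivAt_const w (0 : ℝ × ℝ))).fderiv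
    rw [this]
    simp
  have hsymm : IsSymmSndFDerivAt ℝ G 0 := 
    hG.contDiffAt.isSymmSndFDerivAt (by simpa using WithTop.coe_le_coe.2 (le_top : (2 : ℕ∞) ≤ ⊤))
  rw [happ, hsymm.eq, ← happ, ← deriv_line_zero (contDiff_fderiv_apply_const hG _)]
  refine congrArg (fun f => deriv f 0) (funext fun r => ?_)
  rw [← deriv_line_zero hG]
  refine congrArg (fun f => deriv f 0) (funext fun r' => ?_)
  simp [hGdef, add_assoc, add_comm]

/-- The chain rule: the derivative of a smooth functional along a smooth curve depends only on
the velocity of the curve. -/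
theorem IsSmoothLagrangian.hasDerivAt_comp (hM : IsSmoothLagrangian M)
    {c w : ℝ → KinematicSpace W m} (hw : IsSmoothFamily w) (hcw : ∀ s, c s = c 0 + s • w s)
    {t : ℝ → ℝ} {t' : ℝ} (ht : HasDerivAt t t' 0) :
    HasDerivAt (fun s => M (c s) (t s))
      (dirDeriv M (c 0) (t 0) (w 0) + t' * timeDeriv M (c 0) (t 0)) 0 := by
  -- The parameter `s` is separated into its two roles, as coefficient of `w` and as argument of
  -- `w`. The second contributes nothing at the origin, since the coefficient vanishes there.
  have hG : ContDiff ℝ ∞ fun x : ℝ × ℝ × ℝ => M (c 0 + x.1 • w x.2.1) (t 0 + x.2.2) :=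
    hM (ℝ × ℝ × ℝ) _ _ ((isSmoothFamily_const (c 0)).add
      ((hw.comp_clm ((ContinuousLinearMap.fst ℝ ℝ ℝ).comp (.snd ℝ ℝ (ℝ × ℝ)))).smul
        contDiff_fst)) (by fun_prop)
  set G : ℝ × ℝ × ℝ → ℝ := fun x => M (c 0 + x.1 • w x.2.1) (t 0 + x.2.2) with hGdef
  have hcurve : HasDerivAt (fun s => ((s, s, t s - t 0) : ℝ × ℝ × ℝ)) (1, 1, t') 0 :=
    (hasDerivAt_id _).prodMk ((hasDerivAt_id _).prodMk (ht.sub_const _))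
  have hGd : HasFDerivAt G (fderiv ℝ G 0) ((0 : ℝ), (0 : ℝ), t 0 - t 0) := by
    rw [sub_self]
    exact (hG.differentiable (by simp) _).hasFDerivAt
  have h1 := hGd.comp_hasDerivAt (0 : ℝ) hcurve
  have h2 : (G ∘ fun s => ((s, s, t s - t 0) : ℝ × ℝ × ℝ)) = fun s => M (c s) (t s) := by
    ext s
    simp [hGdef, ← hcw s]
  have h3 : fderiv ℝ G 0 (1, 0, 0) = dirDeriv M (c 0) (t 0) (w 0) := by
    rw [← deriv_line_zero hG]; simp [hGdef, dirDeriv]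
  have h4 : fderiv ℝ G 0 (0, 1, 0) = 0 := by
    rw [← deriv_line_zero hG]; simp [hGdef]
  have h5 : fderiv ℝ G 0 (0, 0, 1) = timeDeriv M (c 0) (t 0) := by
    rw [← deriv_line_zero hG]; simp [hGdef, timeDeriv]
  have h6 : ((1, 1, t') : ℝ × ℝ × ℝ) = (1, 0, 0) + (0, 1, 0) + t' • (0, 0, 1) := by simp
  rw [h2, h6, map_add, map_add, map_smul, h3, h4, h5, add_zero, smul_eq_mul] at h1
  exact h1

end Calculus

/-! ### The functional derivatives of the Lagrangian -/

section FunctionalDerivative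

variable {W : GrowthClass} {m : ℕ} {L : KinematicSpace W m → ℝ → ℝ}

theorem IsSmoothLagrangian.lam_add_smul (hL : IsSmoothLagrangian L)
    (q : KinematicSpace W m) (t τ : ℝ) (u v : KinematicSpace W m) (a b : ℝ) :
    Lam L q t τ (a • u + b • v) = a * Lam L q t τ u + b * Lam L q t τ v :=
  (hL.shifted τ).dirDeriv_add_smul q t u v a b

theorem IsSmoothLagrangian.dLam_comm (hL : IsSmoothLagrangian L)
    (q : KinematicSpace W m) (t τ : ℝ) (u v : KinematicSpace W m) :
    dLam L q t τ u v = dLam L q t τ v u :=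
  (hL.shifted τ).dirDeriv_comm q t u v

theorem IsSmoothLagrangian.dLam_add_smul_left (hL : IsSmoothLagrangian L)
    (q : KinematicSpace W m) (t τ : ℝ) (u v η : KinematicSpace W m) (a b : ℝ) :
    dLam L q t τ (a • u + b • v) η = a * dLam L q t τ u η + b * dLam L q t τ v η :=
  (hL.lam τ η).dirDeriv_add_smul q t u v a b

theorem IsSmoothLagrangian.dLam_add_smul_right (hL : IsSmoothLagrangian L)
    (q : KinematicSpace W m) (t τ : ℝ) (u η ζ : KinematicSpace W m) (a b : ℝ) :
    dLam L q t τ u (a • η + b • ζ) = a * dLam L q t τ u η + b * dLam L q t τ u ζ := by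
  rw [hL.dLam_comm, hL.dLam_add_smul_left, hL.dLam_comm _ _ _ u, hL.dLam_comm _ _ _ u]

theorem IsSmoothLagrangian.dtLam_add_smul (hL : IsSmoothLagrangian L)
    (q : KinematicSpace W m) (t τ : ℝ) (η ζ : KinematicSpace W m) (a b : ℝ) :
    dtLam L q t τ (a • η + b • ζ) = a * dtLam L q t τ η + b * dtLam L q t τ ζ := by
  have hd : ∀ η, DifferentiableAt ℝ (fun r => Lam L q (t + r) τ η) 0 := fun η =>
    ((hL.lam τ η) ℝ _ _ (isSmoothFamily_const q)
      (contDiff_const.add contDiff_id)).differentiable (by simp) 0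
  have := ((hd η).hasDerivAt.const_mul a).add ((hd ζ).hasDerivAt.const_mul b)
  rw [dtLam]
  simp only [hL.lam_add_smul]
  exact this.deriv

/-- The variation of `Λ` in the direction of the tangent vector `V`. -/
noncomputable def varLam (L : KinematicSpace W m → ℝ → ℝ) (p V : KinematicSpace W m × ℝ) (τ : ℝ)
    (η : KinematicSpace W m) : ℝ :=
  dLam L p.1 p.2 τ V.1 η + V.2 * dtLam L p.1 p.2 τ η

theorem IsSmoothLagrangian.varLam_add_smul_left (hL : IsSmoothLagrangian L)
    (p V Z : KinematicSpace W m × ℝ) (τ : ℝ) (η : KinematicSpace W m) (a b : ℝ) :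
    varLam L p (a • V + b • Z) τ η = a * varLam L p V τ η + b * varLam L p Z τ η := by
  simp only [varLam, Prod.fst_add, Prod.snd_add, Prod.smul_fst, Prod.smul_snd,
    hL.dLam_add_smul_left, smul_eq_mul]
  ring

/-- A product rule. By linearity the value is `Λ(η 0) + s Λ(ζ s)`: the first term is handled by the
chain rule, and the second has derivative `Λ(ζ 0)` at `0`. -/
theorem IsSmoothLagrangian.hasDerivAt_lam (hL : IsSmoothLagrangian L)
    {q w η ζ : ℝ → KinematicSpace W m} (hq : IsSmoothFamily q) (hw : IsSmoothFamily w)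
    (hqw : ∀ s, q s = q 0 + s • w s) (hζ : IsSmoothFamily ζ) (hηζ : ∀ s, η s = η 0 + s • ζ s)
    {t : ℝ → ℝ} {t' : ℝ} (ht : ContDiff ℝ ∞ t) (ht' : HasDerivAt t t' 0) (τ : ℝ) :
    HasDerivAt (fun s => Lam L (q s) (t s) τ (η s))
      (varLam L (q 0, t 0) (w 0, t') τ (η 0) + Lam L (q 0) (t 0) τ (ζ 0)) 0 := by
  have h1 := (hL.lam τ (η 0)).hasDerivAt_comp hw hqw ht'
  have h2 : DifferentiableAt ℝ (fun s => Lam L (q s) (t s) τ (ζ s)) 0 :=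
    ((hL.contDiff_lam hq hζ ht).comp
      (by fun_prop : ContDiff ℝ ∞ fun s : ℝ => (s, τ))).differentiable (by simp) 0
  have h3 := h1.add ((hasDerivAt_id (0 : ℝ)).mul h2.hasDerivAt)
  simp only [id, zero_mul, add_zero, one_mul] at h3
  refine h3.congr_of_eventuallyEq (Eventually.of_forall fun s => ?_)
  have := hL.lam_add_smul (q s) (t s) τ (η 0) (ζ s) 1 s
  rw [one_smul, ← hηζ s, one_mul] at this
  exact this

theorem stepMul_add_smul (χ : SmoothStep) (c a b : ℝ) (u v : KinematicSpace W m) :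
    stepMul χ c (a • u + b • v) = a • stepMul χ c u + b • stepMul χ c v := by
  refine Subtype.ext (funext fun σ => ?_)
  change (χ σ - c) • (a • u.1 σ + b • v.1 σ) =
    a • ((χ σ - c) • u.1 σ) + b • ((χ σ - c) • v.1 σ)
  module

theorem IsSmoothLagrangian.lam_stepMul (hL : IsSmoothLagrangian L)
    (q : KinematicSpace W m) (t τ : ℝ) (χ : SmoothStep) (a : ℝ) (η : KinematicSpace W m) :
    Lam L q t τ (stepMul χ a η) = Lam L q t τ (stepMul χ 0 η) - a * Lam L q t τ η := by
  have := hL.lam_add_smul q t τ (stepMul χ 0 η) η 1 (-a)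
  rw [one_smul, ← stepMul_eq] at this
  rw [this]
  ring

theorem IsSmoothLagrangian.dLam_stepMul (hL : IsSmoothLagrangian L)
    (q : KinematicSpace W m) (t τ : ℝ) (χ : SmoothStep) (a : ℝ) (u η : KinematicSpace W m) :
    dLam L q t τ u (stepMul χ a η) = dLam L q t τ u (stepMul χ 0 η) - a * dLam L q t τ u η := by
  have := hL.dLam_add_smul_right q t τ u (stepMul χ 0 η) η 1 (-a)
  rw [one_smul, ← stepMul_eq] at this
  rw [this]
  ring

/-- Covariance under time translation, from `T_τ T_ε = T_{τ+ε}`. -/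
theorem lam_evolution (q : KinematicSpace W m) (t τ ε : ℝ) (η : KinematicSpace W m) :
    Lam L (shift ε q) (t + ε) τ (shift ε η) = Lam L q t (τ + ε) η := by
  refine congrArg (fun f => deriv f 0) (funext fun r => ?_)
  have h1 : shift τ (shift ε q + r • shift ε η) = shift (τ + ε) (q + r • η) := by
    refine Subtype.ext (funext fun σ => ?_)
    change q.1 (ε + (τ + σ)) + r • η.1 (ε + (τ + σ)) =
      q.1 (τ + ε + σ) + r • η.1 (τ + ε + σ)
    rw [show ε + (τ + σ) = τ + ε + σ by ring]
  rw [h1, show t + ε + τ = t + (τ + ε) by ring]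

end FunctionalDerivative

/-! ### The Heaviside limit -/

section Heaviside

/-- The Heaviside function. -/
noncomputable def heaviside (τ : ℝ) : ℝ := Set.indicator (Set.Ici (0 : ℝ)) (fun _ => (1 : ℝ)) τ

/-- The error committed by replacing the Heaviside function by the step `χ` under an integral. -/
noncomputable def stepError (χ : SmoothStep) (f : ℝ → ℝ) : ℝ := ∫ τ, (χ τ - heaviside τ) * f τ

theorem abs_step_sub_heaviside_le (χ : SmoothStep) (τ : ℝ) : |χ τ - heaviside τ| ≤ 1 := by
  have h := χ.mem_Icc τ
  rw [heaviside, Set.indicator_apply]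
  split_ifs <;> rw [abs_le] <;> constructor <;> linarith [h.1, h.2]

theorem step_sub_heaviside_eq_zero {χ : SmoothStep} {R : ℝ} (hR : 0 ≤ R)
    (h0 : ∀ σ ≤ -R, χ σ = 0) (h1 : ∀ σ, R ≤ σ → χ σ = 1) {τ : ℝ} (hτ : τ ∉ Set.Icc (-R) R) :
    χ τ - heaviside τ = 0 := by
  rw [heaviside, Set.indicator_apply]
  rw [Set.mem_Icc, not_and_or, not_le, not_le] at hτ
  rcases hτ with h | h
  · rw [h0 τ h.le, if_neg (by rw [Set.mem_Ici, not_le]; linarith), sub_zero]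
  · rw [h1 τ h.le, if_pos (by rw [Set.mem_Ici]; linarith), sub_self]

theorem SmoothStep.exists_bound (χ : SmoothStep) :
    ∃ R : ℝ, 0 ≤ R ∧ (∀ σ ≤ -R, χ σ = 0) ∧ ∀ σ, R ≤ σ → χ σ = 1 := by
  obtain ⟨R, h0, h1⟩ := χ.eventually_const
  refine ⟨max R 0, le_max_right _ _, fun σ h => h0 σ ?_, fun σ h => h1 σ ?_⟩
  · linarith [le_max_left R 0]
  · linarith [le_max_left R 0]

theorem measurable_heaviside : Measurable heaviside :=
  measurable_const.indicator measurableSet_Ici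

theorem measurable_step_sub_heaviside (χ : SmoothStep) :
    Measurable fun τ => χ τ - heaviside τ :=
  χ.smooth.continuous.measurable.sub measurable_heaviside

/-- `χ - θ` is bounded with compact support, so `f` needs no decay. This matters because `∫ Λ η dτ`
may diverge when `η` is not compactly supported. -/
theorem integrable_step_sub_heaviside_mul (χ : SmoothStep) {f : ℝ → ℝ} (hf : Continuous f) :
    Integrable fun τ => (χ τ - heaviside τ) * f τ := by
  obtain ⟨R, hR, h0, h1⟩ := χ.exists_bound
  have hi : IntegrableOn (fun τ => (χ τ - heaviside τ) * f τ) (Set.Icc (-R) R) := by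
    have hf' : IntegrableOn f (Set.Icc (-R) R) := hf.continuousOn.integrableOn_Icc
    exact Integrable.bdd_mul hf' (measurable_step_sub_heaviside χ).aestronglyMeasurable
      (ae_of_all _ fun τ => abs_step_sub_heaviside_le χ τ)
  refine (integrableOn_iff_integrable_of_support_subset fun τ hτ => ?_).1 hi
  by_contra hmem
  exact hτ (by simp [step_sub_heaviside_eq_zero hR h0 h1 hmem])

theorem stepError_add_smul (χ : SmoothStep) {f g : ℝ → ℝ} (hf : Continuous f) (hg : Continuous g)
    (a b : ℝ) : stepError χ (fun τ => a * f τ + b * g τ) = a * stepError χ f + b * stepError χ g := by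
  rw [stepError, stepError, stepError, ← integral_const_mul, ← integral_const_mul,
    ← integral_add ((integrable_step_sub_heaviside_mul χ hf).const_mul a)
      ((integrable_step_sub_heaviside_mul χ hg).const_mul b)]
  congr 1
  ext τ
  ring

theorem mem_heavisideLimit {ε : ℝ} (hε : 0 < ε) :
    {χ : SmoothStep | (∀ σ ≤ -ε, χ σ = 0) ∧ ∀ σ, ε ≤ σ → χ σ = 1} ∈ heavisideLimit :=
  mem_iInf_of_mem (⟨ε, hε⟩ : Set.Ioi (0 : ℝ)) (mem_principal_self _)

/-- A smooth step with transition interval `[-ε, ε]`. -/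
noncomputable def smoothStep (ε : ℝ) (hε : 0 < ε) : SmoothStep where
  toFun σ := Real.smoothTransition ((σ + ε) / (2 * ε))
  smooth := Real.smoothTransition.contDiff.comp (by fun_prop)
  mem_Icc σ := ⟨Real.smoothTransition.nonneg _, Real.smoothTransition.le_one _⟩
  eventually_const := by
    refine ⟨ε, fun σ h => Real.smoothTransition.zero_of_nonpos ?_, fun σ h =>
      Real.smoothTransition.one_of_one_le ?_⟩
    · exact div_nonpos_of_nonpos_of_nonneg (by linarith) (by linarith)
    · rw [le_div_iff₀ (by linarith)]; linarith

instance : Nonempty SmoothStep := ⟨smoothStep 1 one_pos⟩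

/-- Needed for uniqueness of limits, hence for the momentum to be determined by its defining
convergence. -/
instance : NeBot heavisideLimit := by
  have : Nonempty (Set.Ioi (0 : ℝ)) := ⟨⟨1, Set.mem_Ioi.2 one_pos⟩⟩
  refine iInf_neBot_of_directed ?_ fun ε => ?_
  · intro a b
    refine ⟨⟨min (a : ℝ) b, Set.mem_Ioi.2 (lt_min a.2 b.2)⟩, ?_, ?_⟩ <;>
    · refine principal_mono.2 fun χ hχ => ⟨fun σ h => hχ.1 σ ?_, fun σ h => hχ.2 σ ?_⟩
      · have := min_le_left (a : ℝ) b
        have := min_le_right (a : ℝ) b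
        change σ ≤ -min (a : ℝ) b
        linarith
      · have := min_le_left (a : ℝ) b
        have := min_le_right (a : ℝ) b
        change min (a : ℝ) b ≤ σ
        linarith
  · have hε : (0 : ℝ) < ε := ε.2
    refine principal_neBot_iff.2 ⟨smoothStep ε hε, fun σ h =>
      Real.smoothTransition.zero_of_nonpos ?_, fun σ h => Real.smoothTransition.one_of_one_le ?_⟩
    · exact div_nonpos_of_nonpos_of_nonneg (by linarith) (by linarith)
    · rw [le_div_iff₀ (by linarith)]; linarith

theorem tendsto_stepError {f : ℝ → ℝ} (hf : Continuous f) :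
    Tendsto (fun χ => stepError χ f) heavisideLimit (𝓝 0) := by
  obtain ⟨M, hM⟩ := (isCompact_Icc (a := (-1 : ℝ)) (b := 1)).exists_bound_of_continuousOn
    hf.continuousOn
  have hM0 : 0 ≤ M := (norm_nonneg _).trans (hM 0 (by simp))
  rw [Metric.tendsto_nhds]
  intro e he
  -- The error is at most `2 ε M`, which is below `e` for this choice. The cap `1` keeps the
  -- transition interval inside `[-1, 1]`, where `M` bounds `f`.
  let ε : ℝ := min 1 (e / (4 * (M + 1)))
  have hε : 0 < ε := lt_min one_pos (by positivity)
  filter_upwards [mem_heavisideLimit hε] with χ hχ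
  rw [Real.dist_eq, sub_zero, stepError,
    ← setIntegral_eq_integral_of_forall_compl_eq_zero (s := Set.Icc (-ε) ε) fun τ hτ => by
      rw [step_sub_heaviside_eq_zero hε.le hχ.1 hχ.2 hτ, zero_mul]]
  have hb := norm_setIntegral_le_of_norm_le_const (μ := volume) (s := Set.Icc (-ε) ε)
    (f := fun τ => (χ τ - heaviside τ) * f τ) (C := M) (by simp) fun τ hτ => by
      rw [norm_mul]
      have h1 : ‖f τ‖ ≤ M := hM τ ⟨by linarith [hτ.1, min_le_left (1 : ℝ) (e / (4 * (M + 1)))],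
        hτ.2.trans (min_le_left _ _)⟩
      exact (mul_le_of_le_one_left (norm_nonneg _) (abs_step_sub_heaviside_le χ τ)).trans h1
  have hvol : volume.real (Set.Icc (-ε) ε) = 2 * ε := by
    rw [Real.volume_real_Icc_of_le (by linarith)]; ring
  rw [hvol] at hb
  refine hb.trans_lt ?_
  have h2 : ε ≤ e / (4 * (M + 1)) := min_le_right _ _
  rw [le_div_iff₀ (by positivity)] at h2
  nlinarith

theorem hasDerivAt_stepError (χ : SmoothStep) {g : ℝ × ℝ → ℝ} (hg : ContDiff ℝ ∞ g) :
    HasDerivAt (fun s => stepError χ fun τ => g (s, τ))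
      (stepError χ fun τ => deriv (fun s => g (s, τ)) 0) 0 := by
  obtain ⟨R, hR, h0, h1⟩ := χ.exists_bound
  have hg1 : ∀ s τ, HasDerivAt (fun s => g (s, τ)) (fderiv ℝ g (s, τ) (1, 0)) s := fun s τ =>
    ((hg.differentiable (by simp) (s, τ)).hasFDerivAt).comp_hasDerivAt s
      ((hasDerivAt_id s).prodMk (hasDerivAt_const s τ))
  have hg2 : Continuous fun x => fderiv ℝ g x (1, 0) := (contDiff_fderiv_apply_const hg _).continuous
  obtain ⟨M, hM⟩ := ((isCompact_Icc (a := (-1 : ℝ)) (b := 1)).prod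
    (isCompact_Icc (a := -R) (b := R))).exists_bound_of_continuousOn hg2.continuousOn
  have hcont : ∀ s, Continuous fun τ => g (s, τ) := fun s => hg.continuous.comp (by fun_prop)
  have key := hasDerivAt_integral_of_dominated_loc_of_deriv_le (μ := volume)
    (F := fun s τ => (χ τ - heaviside τ) * g (s, τ))
    (F' := fun s τ => (χ τ - heaviside τ) * fderiv ℝ g (s, τ) (1, 0))
    (bound := Set.indicator (Set.Icc (-R) R) fun _ => M)
    (Icc_mem_nhds (by norm_num : (-1 : ℝ) < 0) one_pos)
    (Eventually.of_forall fun s =>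
      (integrable_step_sub_heaviside_mul χ (hcont s)).aestronglyMeasurable)
    (integrable_step_sub_heaviside_mul χ (hcont 0))
    (integrable_step_sub_heaviside_mul χ
      (hg2.comp (by fun_prop : Continuous fun τ : ℝ => ((0 : ℝ), τ)))).aestronglyMeasurable
    (ae_of_all _ fun τ s hs => by
      by_cases hτ : τ ∈ Set.Icc (-R) R
      · rw [Set.indicator_of_mem hτ, norm_mul]
        exact (mul_le_of_le_one_left (norm_nonneg _) (abs_step_sub_heaviside_le χ τ)).trans
          (hM (s, τ) ⟨hs, hτ⟩)
      · rw [Set.indicator_of_notMem hτ, step_sub_heaviside_eq_zero hR h0 h1 hτ, zero_mul, norm_zero])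
    ((integrable_indicator_iff measurableSet_Icc).2 (integrableOn_const (by simp)))
    (ae_of_all _ fun τ s _ => (hg1 s τ).const_mul _)
  have h3 := key.2
  simp only [← (hg1 0 _).deriv] at h3
  exact h3

end Heaviside

/-! ### The momentum -/

section Momentum

variable {W : GrowthClass} {m : ℕ} {L : KinematicSpace W m → ℝ → ℝ}

theorem IsSmoothLagrangian.continuous_lam (hL : IsSmoothLagrangian L) (q : KinematicSpace W m)
    (t : ℝ) (η : KinematicSpace W m) : Continuous fun τ => Lam L q t τ η :=
  (hL.contDiff_lam (E := ℝ) (isSmoothFamily_const q) (isSmoothFamily_const η)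
    contDiff_const (t := fun _ => t)).continuous.comp (by fun_prop : Continuous fun τ : ℝ => ((0 : ℝ), τ))

theorem IsSmoothLagrangian.contDiff_lam_step (hL : IsSmoothLagrangian L)
    {q η : ℝ → KinematicSpace W m} {t : ℝ → ℝ}
    (hq : IsSmoothFamily q) (hη : IsSmoothFamily η) (ht : ContDiff ℝ ∞ t) (χ : SmoothStep) :
    ContDiff ℝ ∞ fun x : ℝ × ℝ => Lam L (q x.1) (t x.1) x.2 (stepMul χ (χ x.2) (η x.1)) := by
  simp only [fun x : ℝ × ℝ => hL.lam_stepMul (q x.1) (t x.1) x.2 χ (χ x.2)]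
  exact (hL.contDiff_lam hq (hη.stepMul χ) ht).sub
    ((χ.smooth.comp contDiff_snd).mul (hL.contDiff_lam hq hη ht))

theorem IsSummableLagrangian.integrable_lam (hsum : IsSummableLagrangian L)
    (hL : IsSmoothLagrangian L) (p : KinematicSpace W m × ℝ) (χ : SmoothStep)
    (η : KinematicSpace W m) : Integrable fun τ => Lam L p.1 p.2 τ (stepMul χ (χ τ) η) := by
  have hq := isSmoothFamily_const (E := ℝ) p.1
  have hη := isSmoothFamily_const (E := ℝ) η
  have ht : ContDiff ℝ ∞ fun _ : ℝ => p.2 := contDiff_const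
  obtain ⟨g, hg, hle⟩ := hsum _ _ _ hq hη ht χ
  refine hg.mono' ((hL.contDiff_lam_step hq hη ht χ).continuous.comp
    (by fun_prop : Continuous fun τ : ℝ => ((0 : ℝ), τ))).aestronglyMeasurable
    (ae_of_all _ fun τ => (hle 0 (by simp) τ).1)

/-- On the dynamic space the regularized momentum depends on the step only through the error
made at the transition. -/
theorem regMomentum_add_stepError (hL : IsSmoothLagrangian L) (hsum : IsSummableLagrangian L)
    {p : KinematicSpace W m × ℝ} (hp : p ∈ DynamicSpace L) (χ χ' : SmoothStep)
    (η : KinematicSpace W m) :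
    regMomentum L p χ η + stepError χ (fun τ => Lam L p.1 p.2 τ η) =
      regMomentum L p χ' η + stepError χ' (fun τ => Lam L p.1 p.2 τ η) := by
  -- `φ = (χ - χ')η` is an admissible test trajectory for `Ψ = 0`.
  let φ : KinematicSpace W m := (1 : ℝ) • stepMul χ 0 η + (-1 : ℝ) • stepMul χ' 0 η
  have hφ : HasCompactSupport φ.1 := by
    obtain ⟨R, hR, h0, h1⟩ := χ.exists_bound
    obtain ⟨R', hR', h0', h1'⟩ := χ'.exists_bound
    refine HasCompactSupport.intro (isCompact_Icc (a := -max R R') (b := max R R')) fun σ hσ => ?_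
    change (1 : ℝ) • (χ σ - 0) • η.1 σ + (-1 : ℝ) • (χ' σ - 0) • η.1 σ = 0
    rw [Set.mem_Icc, not_and_or, not_le, not_le] at hσ
    rcases hσ with h | h
    · rw [h0 σ (by linarith [le_max_left R R']), h0' σ (by linarith [le_max_right R R'])]
      simp
    · rw [h1 σ (by linarith [le_max_left R R']), h1' σ (by linarith [le_max_right R R'])]
      simp
  obtain ⟨hφ1, hφ2⟩ := hp φ hφ
  have hf := hL.continuous_lam p.1 p.2 η
  have e1 := integrable_step_sub_heaviside_mul χ hf
  have e2 := integrable_step_sub_heaviside_mul χ' hf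
  have i1 := hsum.integrable_lam hL p χ η
  have i2 := hsum.integrable_lam hL p χ' η
  -- Adding the error replaces `χ(σ) - χ(τ)` by `χ(σ) - θ(τ)`, so the two integrands differ exactly
  -- by `Λ φ`. The comparison is made before splitting, since only these combinations are known to
  -- be integrable.
  have h : (∫ τ, (Lam L p.1 p.2 τ (stepMul χ (χ τ) η) +
      (χ τ - heaviside τ) * Lam L p.1 p.2 τ η)) =
      ∫ τ, ((Lam L p.1 p.2 τ (stepMul χ' (χ' τ) η) +
      (χ' τ - heaviside τ) * Lam L p.1 p.2 τ η) + Lam L p.1 p.2 τ φ) := by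
    congr 1
    ext τ
    rw [hL.lam_add_smul, hL.lam_stepMul _ _ _ χ (χ τ), hL.lam_stepMul _ _ _ χ' (χ' τ)]
    ring
  have hs : Integrable fun τ => Lam L p.1 p.2 τ (stepMul χ' (χ' τ) η) +
      (χ' τ - heaviside τ) * Lam L p.1 p.2 τ η := i2.add e2
  rw [integral_add i1 e1, integral_add hs hφ1, hφ2, add_zero, integral_add i2 e2] at h
  exact h

theorem tendsto_regMomentum (hL : IsSmoothLagrangian L) (hsum : IsSummableLagrangian L)
    {p : KinematicSpace W m × ℝ} (hp : p ∈ DynamicSpace L) (χ : SmoothStep)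
    (η : KinematicSpace W m) :
    Tendsto (fun χ => regMomentum L p χ η) heavisideLimit
      (𝓝 (regMomentum L p χ η + stepError χ (fun τ => Lam L p.1 p.2 τ η))) := by
  have h := (tendsto_const_nhds (x := regMomentum L p χ η +
    stepError χ (fun τ => Lam L p.1 p.2 τ η)) (f := heavisideLimit)).sub
      (tendsto_stepError (hL.continuous_lam p.1 p.2 η))
  rw [sub_zero] at h
  refine h.congr fun χ' => ?_
  rw [regMomentum_add_stepError hL hsum hp χ χ']
  ring

theorem isMomentum_momentum (hL : IsSmoothLagrangian L) (hsum : IsSummableLagrangian L)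
    {p : KinematicSpace W m × ℝ} (hp : p ∈ DynamicSpace L) : IsMomentum L p (momentum L p) := by
  have h : ∃ π, IsMomentum L p π := by
    let χ := smoothStep 1 one_pos
    have hlin : ∀ (a b : ℝ) (η ζ : KinematicSpace W m),
        regMomentum L p χ (a • η + b • ζ) +
          stepError χ (fun τ => Lam L p.1 p.2 τ (a • η + b • ζ)) =
        a * (regMomentum L p χ η + stepError χ (fun τ => Lam L p.1 p.2 τ η)) +
          b * (regMomentum L p χ ζ + stepError χ (fun τ => Lam L p.1 p.2 τ ζ)) := by
      intro a b η ζ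
      have h1 : regMomentum L p χ (a • η + b • ζ) =
          a * regMomentum L p χ η + b * regMomentum L p χ ζ := by
        simp only [regMomentum, stepMul_add_smul, hL.lam_add_smul]
        rw [integral_add ((hsum.integrable_lam hL p χ η).const_mul a)
          ((hsum.integrable_lam hL p χ ζ).const_mul b), integral_const_mul, integral_const_mul]
      simp only [hL.lam_add_smul]
      rw [h1, stepError_add_smul χ (hL.continuous_lam _ _ _) (hL.continuous_lam _ _ _)]
      ring
    -- The witness is the step-independent expression, evaluated at one arbitrary step.
    refine ⟨⟨⟨fun η => regMomentum L p χ η + stepError χ (fun τ => Lam L p.1 p.2 τ η),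
      fun η ζ => ?_⟩, fun a η => ?_⟩, fun η => tendsto_regMomentum hL hsum hp χ η⟩
    · simpa using hlin 1 1 η ζ
    · simpa using hlin a 0 η η
  rw [momentum, dif_pos h]
  exact h.choose_spec

/-- The limit defining the momentum becomes an identity at every fixed step; differentiation and
time evolution both rest on this. -/
theorem momentum_eq (hL : IsSmoothLagrangian L) (hsum : IsSummableLagrangian L)
    {p : KinematicSpace W m × ℝ} (hp : p ∈ DynamicSpace L) (χ : SmoothStep)
    (η : KinematicSpace W m) :
    momentum L p η = regMomentum L p χ η + stepError χ (fun τ => Lam L p.1 p.2 τ η) :=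
  tendsto_nhds_unique (isMomentum_momentum hL hsum hp η) (tendsto_regMomentum hL hsum hp χ η)

/-! ### Derivatives of the momentum along curves. -/

theorem IsSummableLagrangian.hasDerivAt_regMomentum (hsum : IsSummableLagrangian L)
    (hL : IsSmoothLagrangian L)
    {q w η ζ : ℝ → KinematicSpace W m} (hq : IsSmoothFamily q) (hw : IsSmoothFamily w)
    (hqw : ∀ s, q s = q 0 + s • w s) (hη : IsSmoothFamily η) (hζ : IsSmoothFamily ζ)
    (hηζ : ∀ s, η s = η 0 + s • ζ s) {t : ℝ → ℝ} {t' : ℝ} (ht : ContDiff ℝ ∞ t)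
    (ht' : HasDerivAt t t' 0) (χ : SmoothStep) :
    Integrable (fun τ => varLam L (q 0, t 0) (w 0, t') τ (stepMul χ (χ τ) (η 0)) +
      Lam L (q 0) (t 0) τ (stepMul χ (χ τ) (ζ 0))) ∧
    HasDerivAt (fun s => regMomentum L (q s, t s) χ (η s))
      (∫ τ, (varLam L (q 0, t 0) (w 0, t') τ (stepMul χ (χ τ) (η 0)) +
        Lam L (q 0) (t 0) τ (stepMul χ (χ τ) (ζ 0)))) 0 := by
  obtain ⟨g, hg, hle⟩ := hsum q η t hq hη ht χ
  have hF := hL.contDiff_lam_step hq hη ht χ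
  have hτ : ∀ s : ℝ, Continuous fun τ : ℝ => (s, τ) := fun s => by fun_prop
  have hdiff : ∀ τ, Differentiable ℝ fun s => Lam L (q s) (t s) τ (stepMul χ (χ τ) (η s)) :=
    fun τ => (hF.comp (by fun_prop : ContDiff ℝ ∞ fun s : ℝ => (s, τ))).differentiable (by simp)
  have hval : ∀ τ, deriv (fun s => Lam L (q s) (t s) τ (stepMul χ (χ τ) (η s))) 0 =
      varLam L (q 0, t 0) (w 0, t') τ (stepMul χ (χ τ) (η 0)) +
        Lam L (q 0) (t 0) τ (stepMul χ (χ τ) (ζ 0)) := by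
    intro τ
    refine (hL.hasDerivAt_lam (η := fun s => stepMul χ (χ τ) (η s))
      (ζ := fun s => stepMul χ (χ τ) (ζ s)) hq hw hqw ?_ (fun s => ?_) ht ht' τ).deriv
    · simp only [stepMul_eq χ (χ τ)]
      exact (hζ.stepMul χ).add (hζ.smul contDiff_const)
    · have := stepMul_add_smul χ (χ τ) 1 s (η 0) (ζ s)
      rw [one_smul, one_smul, ← hηζ] at this
      exact this
  have hF' : Continuous fun τ =>
      deriv (fun s => Lam L (q s) (t s) τ (stepMul χ (χ τ) (η s))) 0 :=
    (contDiff_deriv_zero (G := fun x : ℝ × ℝ =>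
      Lam L (q x.2) (t x.2) x.1 (stepMul χ (χ x.1) (η x.2)))
      (hF.comp (by fun_prop : ContDiff ℝ ∞ fun x : ℝ × ℝ => (x.2, x.1)))).continuous
  have key := hasDerivAt_integral_of_dominated_loc_of_deriv_le (μ := volume)
    (F := fun s τ => Lam L (q s) (t s) τ (stepMul χ (χ τ) (η s)))
    (F' := fun s τ => deriv (fun s => Lam L (q s) (t s) τ (stepMul χ (χ τ) (η s))) s)
    (bound := g) (Icc_mem_nhds (by norm_num : (-1 : ℝ) < 0) one_pos)
    (Eventually.of_forall fun s => (hF.continuous.comp (hτ s)).aestronglyMeasurable)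
    (hsum.integrable_lam hL (q 0, t 0) χ (η 0)) hF'.aestronglyMeasurable
    (ae_of_all _ fun τ s hs => (hle s hs τ).2) hg
    (ae_of_all _ fun τ s _ => (hdiff τ s).hasDerivAt)
  simp only [hval] at key
  exact key

theorem isSmoothFamily_line (q u : KinematicSpace W m) :
    IsSmoothFamily fun s : ℝ => q + s • u :=
  (isSmoothFamily_const q).add ((isSmoothFamily_const u).smul contDiff_id)

/-- Summability is assumed along all smooth curves, so it may be used on the straight line `p + s
V`, which need not stay in `𝒟'`. Therefore `V` need not be tangent. -/
theorem IsSummableLagrangian.integrable_varLam (hsum : IsSummableLagrangian L)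
    (hL : IsSmoothLagrangian L) (p V : KinematicSpace W m × ℝ) (χ : SmoothStep)
    (η : KinematicSpace W m) : Integrable fun τ => varLam L p V τ (stepMul χ (χ τ) η) := by
  have ht : HasDerivAt (fun s : ℝ => p.2 + s * V.2) V.2 0 := by
    simpa using ((hasDerivAt_id (0 : ℝ)).mul_const V.2).const_add p.2
  have h := (hsum.hasDerivAt_regMomentum hL (isSmoothFamily_line p.1 V.1)
    (isSmoothFamily_const V.1) (by simp) (isSmoothFamily_const η)
    (isSmoothFamily_const (0 : KinematicSpace W m)) (by simp) (by fun_prop) ht χ).1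
  refine (h.sub (hsum.integrable_lam hL p χ 0)).congr (ae_of_all _ fun τ => ?_)
  simp

theorem IsSmoothLagrangian.continuous_varLam (hL : IsSmoothLagrangian L)
    (p V : KinematicSpace W m × ℝ) (η : KinematicSpace W m) :
    Continuous fun τ => varLam L p V τ η := by
  have ht : HasDerivAt (fun s : ℝ => p.2 + s * V.2) V.2 0 := by
    simpa using ((hasDerivAt_id (0 : ℝ)).mul_const V.2).const_add p.2
  have htc : ContDiff ℝ ∞ fun s : ℝ => p.2 + s * V.2 := by fun_prop
  have hval : ∀ τ, deriv (fun s : ℝ => Lam L (p.1 + s • V.1) (p.2 + s * V.2) τ η) 0 =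
      varLam L p V τ η + Lam L p.1 p.2 τ 0 := by
    intro τ
    simpa using (hL.hasDerivAt_lam (η := fun _ => η) (ζ := fun _ => 0)
      (isSmoothFamily_line p.1 V.1) (isSmoothFamily_const V.1) (by simp)
      (isSmoothFamily_const (0 : KinematicSpace W m)) (by simp) htc ht τ).deriv
  have h := (contDiff_deriv_zero (G := fun x : ℝ × ℝ =>
    Lam L (p.1 + x.2 • V.1) (p.2 + x.2 * V.2) x.1 η)
    ((hL.contDiff_lam (isSmoothFamily_line p.1 V.1) (isSmoothFamily_const η) htc).comp
      (by fun_prop : ContDiff ℝ ∞ fun x : ℝ × ℝ => (x.2, x.1)))).continuous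
  simp only [hval] at h
  exact (h.sub (hL.continuous_lam p.1 p.2 0)).congr fun τ => by simp

/-- The variation of the momentum in the direction of the tangent vector `V`. -/
noncomputable def varMomentum (L : KinematicSpace W m → ℝ → ℝ) (χ : SmoothStep)
    (p V : KinematicSpace W m × ℝ) (η : KinematicSpace W m) : ℝ :=
  (∫ τ, varLam L p V τ (stepMul χ (χ τ) η)) + stepError χ fun τ => varLam L p V τ η

/-- The velocity of a curve is prescribed only pointwise in `σ`; this identifies it with the
Hadamard slope at `0`. -/
theorem IsCurve.exists_slope {c : ℝ → KinematicSpace W m × ℝ} {p V : KinematicSpace W m × ℝ}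
    (hc : IsCurve L c p V) : ∃ w : ℝ → KinematicSpace W m, IsSmoothFamily w ∧
      (∀ s, (c s).1 = (c 0).1 + s • w s) ∧ w 0 = V.1 := by
  obtain ⟨w, hw, hcw⟩ := hc.smooth_fst.exists_slope
  exact ⟨w, hw, hcw, Subtype.ext (funext fun σ =>
    (hw.slope_zero hcw σ).unique (hc.velocity_fst σ))⟩

theorem IsCurve.hasDerivAt_momentum {c : ℝ → KinematicSpace W m × ℝ}
    {p V : KinematicSpace W m × ℝ} (hc : IsCurve L c p V) (hL : IsSmoothLagrangian L)
    (hsum : IsSummableLagrangian L) {η ζ : ℝ → KinematicSpace W m} (hη : IsSmoothFamily η)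
    (hζ : IsSmoothFamily ζ) (hηζ : ∀ s, η s = η 0 + s • ζ s) (χ : SmoothStep) :
    HasDerivAt (fun s => momentum L (c s) (η s))
      (varMomentum L χ p V (η 0) + momentum L p (ζ 0)) 0 := by
  obtain ⟨w, hw, hcw, hw0⟩ := hc.exists_slope
  have hp : p ∈ DynamicSpace L := hc.base ▸ hc.mem 0
  have h1 := (hsum.hasDerivAt_regMomentum hL hc.smooth_fst hw hcw hη hζ hηζ hc.smooth_snd
    hc.velocity_snd χ).2
  have h2 := hasDerivAt_stepError χ (hL.contDiff_lam hc.smooth_fst hη hc.smooth_snd)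
  have h3 := fun τ => (hL.hasDerivAt_lam hc.smooth_fst hw hcw hζ hηζ hc.smooth_snd
    hc.velocity_snd τ).deriv
  have h4 := h1.add h2
  simp only [h3, hw0, hc.base, Prod.mk.eta] at h4
  -- The whole curve lies in `𝒟'`, so the exact expression with the same `χ` is valid at every
  -- parameter value.
  simp only [momentum_eq hL hsum (hc.mem _) χ, momentum_eq hL hsum hp χ]
  have h5 := stepError_add_smul χ (hL.continuous_varLam p V (η 0))
    (hL.continuous_lam p.1 p.2 (ζ 0)) 1 1
  simp only [one_mul] at h5
  rw [integral_add (hsum.integrable_varLam hL p V χ (η 0)) (hsum.integrable_lam hL p χ (ζ 0)),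
    h5] at h4
  rw [varMomentum, regMomentum, add_add_add_comm]
  exact h4

end Momentum

/-! ### The tangent map and the differential of the reduced Hamiltonian -/

section Tangent

variable {W : GrowthClass} {m : ℕ} {L : KinematicSpace W m → ℝ → ℝ}
  {p V Z : KinematicSpace W m × ℝ}

theorem velocity_add_smul (u v : KinematicSpace W m) (a b : ℝ) :
    velocity (a • u + b • v) = a • velocity u + b • velocity v := by
  refine Subtype.ext (funext fun σ => ?_)
  have hu : DifferentiableAt ℝ u.1 σ := (u.2.1 : ContDiff ℝ ∞ u.1).differentiable (by simp) σ
  have hv : DifferentiableAt ℝ v.1 σ := (v.2.1 : ContDiff ℝ ∞ v.1).differentiable (by simp) σ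
  exact ((hu.hasDerivAt.const_smul a).add (hv.hasDerivAt.const_smul b)).deriv

theorem velocity_add_smul_right (u v : KinematicSpace W m) (b : ℝ) :
    velocity (u + b • v) = velocity u + b • velocity v := by
  simpa using velocity_add_smul u v 1 b

theorem IsCurve.hasDerivAt_momentum_const {c : ℝ → KinematicSpace W m × ℝ}
    (hc : IsCurve L c p V) (hL : IsSmoothLagrangian L) (hsum : IsSummableLagrangian L)
    (χ : SmoothStep) (η : KinematicSpace W m) :
    HasDerivAt (fun s => momentum L (c s) η) (varMomentum L χ p V η) 0 := by
  simpa using hc.hasDerivAt_momentum hL hsum (isSmoothFamily_const η)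
    (isSmoothFamily_const (0 : KinematicSpace W m)) (by simp) χ

theorem varMomentum_add_smul (hL : IsSmoothLagrangian L) (hsum : IsSummableLagrangian L)
    (χ : SmoothStep) (p V Z : KinematicSpace W m × ℝ) (η : KinematicSpace W m) (a b : ℝ) :
    varMomentum L χ p (a • V + b • Z) η =
      a * varMomentum L χ p V η + b * varMomentum L χ p Z η := by
  simp only [varMomentum, hL.varLam_add_smul_left]
  rw [stepError_add_smul χ (hL.continuous_varLam p V η) (hL.continuous_varLam p Z η),
    integral_add ((hsum.integrable_varLam hL p V χ η).const_mul a)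
      ((hsum.integrable_varLam hL p Z χ η).const_mul b), integral_const_mul, integral_const_mul]
  ring

theorem IsPushforward.unique {Y Y' : PhaseSpace W m} (hV : V ∈ TangentSet L p)
    (hY : IsPushforward L p V Y) (hY' : IsPushforward L p V Y') : Y = Y' := by
  obtain ⟨c, hc⟩ := hV
  obtain ⟨h1, h2, h3⟩ := hY c hc
  obtain ⟨h1', h2', h3'⟩ := hY' c hc
  exact Prod.ext (Subtype.ext (funext fun σ => (h1 σ).unique (h1' σ)))
    (Prod.ext (LinearMap.ext fun η => (h2 η).unique (h2' η)) (h3.unique h3'))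

theorem exists_isPushforward (hL : IsSmoothLagrangian L) (hsum : IsSummableLagrangian L)
    (χ : SmoothStep) (hV : V ∈ TangentSet L p) :
    ∃ Y : PhaseSpace W m, IsPushforward L p V Y ∧ Y.1 = V.1 ∧
      (∀ η, Y.2.1 η = varMomentum L χ p V η) ∧ Y.2.2 = V.2 := by
  obtain ⟨c, hc⟩ := hV
  have hlin : ∀ (a b : ℝ) (η ζ : KinematicSpace W m), varMomentum L χ p V (a • η + b • ζ) =
      a * varMomentum L χ p V η + b * varMomentum L χ p V ζ := by
    intro a b η ζ
    -- Linearity in the test trajectory is inherited from the momentum covectors along the curve, by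
    -- uniqueness of the derivative.
    refine (hc.hasDerivAt_momentum_const hL hsum χ _).unique ?_
    simp only [map_add, map_smul, smul_eq_mul]
    exact ((hc.hasDerivAt_momentum_const hL hsum χ η).const_mul a).add
      ((hc.hasDerivAt_momentum_const hL hsum χ ζ).const_mul b)
  refine ⟨⟨V.1, ⟨⟨varMomentum L χ p V, fun η ζ => ?_⟩, fun a η => ?_⟩, V.2⟩,
    fun d hd => ⟨hd.velocity_fst, hd.hasDerivAt_momentum_const hL hsum χ, hd.velocity_snd⟩,
    rfl, fun _ => rfl, rfl⟩
  · simpa using hlin 1 1 η ζ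
  · simpa using hlin a 0 η η

theorem isPushforward_pushforward (hL : IsSmoothLagrangian L) (hsum : IsSummableLagrangian L)
    (hV : V ∈ TangentSet L p) : IsPushforward L p V (pushforward L p V) := by
  obtain ⟨Y, hY, -⟩ := exists_isPushforward hL hsum (smoothStep 1 one_pos) hV
  have h : ∃ Y, IsPushforward L p V Y := ⟨Y, hY⟩
  rw [pushforward, dif_pos h]
  exact h.choose_spec

/-- `χ` is arbitrary here, so on tangent vectors `varMomentum` does not depend on it; later
arguments choose the step freely. -/
theorem pushforward_spec (hL : IsSmoothLagrangian L) (hsum : IsSummableLagrangian L)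
    (χ : SmoothStep) (hV : V ∈ TangentSet L p) :
    (pushforward L p V).1 = V.1 ∧
      (∀ η, (pushforward L p V).2.1 η = varMomentum L χ p V η) ∧
      (pushforward L p V).2.2 = V.2 := by
  obtain ⟨Y, hY, h⟩ := exists_isPushforward hL hsum χ hV
  rw [IsPushforward.unique hV (isPushforward_pushforward hL hsum hV) hY]
  exact h

theorem omega_eq (hL : IsSmoothLagrangian L) (hsum : IsSummableLagrangian L) (χ : SmoothStep)
    (hV : V ∈ TangentSet L p) (hZ : Z ∈ TangentSet L p) :
    omega L p V Z = varMomentum L χ p V Z.1 - varMomentum L χ p Z V.1 := by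
  obtain ⟨hV1, hV2, -⟩ := pushforward_spec hL hsum χ hV
  obtain ⟨hZ1, hZ2, -⟩ := pushforward_spec hL hsum χ hZ
  rw [omega, Omega, hV2, hZ2, hV1, hZ1]

/-- The differential of the reduced Hamiltonian, in terms of the variation of the momentum. -/
noncomputable def varHam (L : KinematicSpace W m → ℝ → ℝ) (χ : SmoothStep)
    (p V : KinematicSpace W m × ℝ) : ℝ :=
  varMomentum L χ p V (velocity p.1) + momentum L p (velocity V.1) -
    (dirDeriv L p.1 p.2 V.1 + V.2 * timeDeriv L p.1 p.2)

theorem hasDifferential_redHam (hL : IsSmoothLagrangian L) (hsum : IsSummableLagrangian L)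
    (χ : SmoothStep) : HasDifferential L (redHam L) p V (varHam L χ p V) := by
  intro c hc
  obtain ⟨w, hw, hcw, hw0⟩ := hc.exists_slope
  -- In `P(c s)(q̇_s)` the test trajectory moves too. Its slope is the velocity of the slope `w`,
  -- which produces the term `P(δq̇)`.
  have h1 := hc.hasDerivAt_momentum hL hsum hc.smooth_fst.velocity hw.velocity
    (fun s => by rw [← velocity_add_smul_right, ← hcw s]) χ
  have h2 := hL.hasDerivAt_comp hw hcw hc.velocity_snd
  have h3 := h1.sub h2
  rw [hw0, hc.base] at h3
  exact h3

theorem HasDifferential.unique {F : KinematicSpace W m × ℝ → ℝ} {y y' : ℝ}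
    (hV : V ∈ TangentSet L p) (h : HasDifferential L F p V y) (h' : HasDifferential L F p V y') :
    y = y' := by
  obtain ⟨c, hc⟩ := hV
  exact (h c hc).unique (h' c hc)

theorem hasDifferential_differential {F : KinematicSpace W m × ℝ → ℝ} {y : ℝ}
    (h : HasDifferential L F p V y) : HasDifferential L F p V (differential L F p V) := by
  have h' : ∃ y, HasDifferential L F p V y := ⟨y, h⟩
  rw [differential, dif_pos h']
  exact h'.choose_spec

theorem differential_redHam (hL : IsSmoothLagrangian L) (hsum : IsSummableLagrangian L)
    (χ : SmoothStep) (hV : V ∈ TangentSet L p) :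
    differential L (redHam L) p V = varHam L χ p V :=
  HasDifferential.unique hV
    (hasDifferential_differential (hasDifferential_redHam hL hsum χ))
    (hasDifferential_redHam hL hsum χ)

theorem dHam_eq (hL : IsSmoothLagrangian L) (x Y : PhaseSpace W m) :
    dHam L x Y = Y.2.1 (velocity x.1) + x.2.1 (velocity Y.1) -
      (dirDeriv L x.1 x.2.2 Y.1 + Y.2.2 * timeDeriv L x.1 x.2.2) := by
  have h1 := hL.hasDerivAt_comp (c := fun r : ℝ => x.1 + r • Y.1) (t := fun r => x.2.2 + r * Y.2.2)
    (isSmoothFamily_const Y.1) (by simp)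
    (((hasDerivAt_id (0 : ℝ)).mul_const Y.2.2).const_add x.2.2)
  -- Along the line `x + r Y` the pairing `π(q̇)` is quadratic in `r`; its linear coefficient is the
  -- derivative.
  have h2 : HasDerivAt (fun r : ℝ => x.2.1 (velocity x.1) +
      r * (Y.2.1 (velocity x.1) + x.2.1 (velocity Y.1)) + r ^ 2 * Y.2.1 (velocity Y.1))
      (Y.2.1 (velocity x.1) + x.2.1 (velocity Y.1)) 0 := by
    have := (((hasDerivAt_id (0 : ℝ)).mul_const
      (Y.2.1 (velocity x.1) + x.2.1 (velocity Y.1))).const_add (x.2.1 (velocity x.1))).add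
      (((hasDerivAt_id (0 : ℝ)).pow 2).mul_const (Y.2.1 (velocity Y.1)))
    exact this.congr_deriv (by simp)
  have h3 := h2.sub h1
  simp only [zero_smul, zero_mul, add_zero, one_mul] at h3
  rw [dHam, ← h3.deriv]
  refine congrArg (fun f => deriv f 0) (funext fun r => ?_)
  change (x.2.1 + r • Y.2.1) (velocity (x.1 + r • Y.1)) -
    L (x.1 + r • Y.1) (x.2.2 + r • Y.2.2) = _
  rw [velocity_add_smul_right]
  simp only [LinearMap.add_apply, LinearMap.smul_apply, map_add, map_smul, smul_eq_mul,
    Pi.sub_apply]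
  ring

/-- The chain rule `δh = j^* δH`: `δH` is taken along straight lines of the phase space and `δh`
along curves in `𝒟'`, and both give `varHam`. -/
theorem dHam_pushforward (hL : IsSmoothLagrangian L) (hsum : IsSummableLagrangian L)
    (χ : SmoothStep) (hV : V ∈ TangentSet L p) :
    dHam L (inj L p) (pushforward L p V) = varHam L χ p V := by
  obtain ⟨hV1, hV2, hV3⟩ := pushforward_spec hL hsum χ hV
  rw [dHam_eq hL, hV1, hV2, hV3]
  rfl

theorem omegaPrime_eq (hL : IsSmoothLagrangian L) (hsum : IsSummableLagrangian L)
    (χ : SmoothStep) (hV : V ∈ TangentSet L p) (hZ : Z ∈ TangentSet L p) :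
    omegaPrime L p V Z = omega L p V Z - (varHam L χ p V * Z.2 - varHam L χ p Z * V.2) := by
  rw [omegaPrime, OmegaPrime, dHam_pushforward hL hsum χ hV, dHam_pushforward hL hsum χ hZ,
    (pushforward_spec hL hsum χ hV).2.2, (pushforward_spec hL hsum χ hZ).2.2]
  rfl

theorem varHam_add_smul (hL : IsSmoothLagrangian L) (hsum : IsSummableLagrangian L)
    (χ : SmoothStep) (p V Z : KinematicSpace W m × ℝ) (a b : ℝ) :
    varHam L χ p (a • V + b • Z) = a * varHam L χ p V + b * varHam L χ p Z := by
  simp only [varHam, varMomentum_add_smul hL hsum, Prod.fst_add, Prod.snd_add, Prod.smul_fst,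
    Prod.smul_snd, velocity_add_smul, hL.dirDeriv_add_smul, map_add, map_smul, smul_eq_mul]
  ring

theorem omegaPrime_add_smul (hL : IsSmoothLagrangian L) (hsum : IsSummableLagrangian L)
    {V₁ V₂ : KinematicSpace W m × ℝ} (h₁ : V₁ ∈ TangentSet L p) (h₂ : V₂ ∈ TangentSet L p)
    (hZ : Z ∈ TangentSet L p) (a b : ℝ) (h : a • V₁ + b • V₂ ∈ TangentSet L p) :
    omegaPrime L p (a • V₁ + b • V₂) Z = a * omegaPrime L p V₁ Z + b * omegaPrime L p V₂ Z := by
  let χ := smoothStep 1 one_pos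
  rw [omegaPrime_eq hL hsum χ h hZ, omegaPrime_eq hL hsum χ h₁ hZ, omegaPrime_eq hL hsum χ h₂ hZ,
    omega_eq hL hsum χ h hZ, omega_eq hL hsum χ h₁ hZ, omega_eq hL hsum χ h₂ hZ,
    varHam_add_smul hL hsum, varMomentum_add_smul hL hsum]
  -- Identifying `varMomentum χ p Z` with a genuine covector makes it linear in the trajectory
  -- argument.
  obtain ⟨hZ1, hZ2, -⟩ := pushforward_spec hL hsum χ hZ
  simp only [← hZ2, Prod.fst_add, Prod.snd_add, Prod.smul_fst, Prod.smul_snd, map_add, map_smul,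
    smul_eq_mul]
  ring

end Tangent

/-! ### The explicit formula for the presymplectic form -/

section Formula

variable {W : GrowthClass} {m : ℕ} {L : KinematicSpace W m → ℝ → ℝ}
  {p V Z : KinematicSpace W m × ℝ}

theorem dtLam_eq_varLam (p : KinematicSpace W m × ℝ) (τ : ℝ) (η : KinematicSpace W m) :
    dtLam L p.1 p.2 τ η = varLam L p (0, 1) τ η := by
  simp [varLam, dLam]

theorem dLam_eq_varLam (p : KinematicSpace W m × ℝ) (τ : ℝ) (u η : KinematicSpace W m) :
    dLam L p.1 p.2 τ u η = varLam L p (u, 0) τ η := by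
  simp [varLam]

/-- Symmetry of the second variation makes the `χ(σ)` and `-χ(ρ)` contributions equal after
antisymmetrization, which accounts for the factor `1/2`. It also cancels the coefficient `χ(τ)`
between the two integrals on the right. The explicit time variation has no such symmetry and keeps
its `χ(τ)`. -/
theorem regOmega_add_regTimeTerm (hL : IsSmoothLagrangian L) (hsum : IsSummableLagrangian L)
    (p : KinematicSpace W m × ℝ) (χ : SmoothStep) (V Z : KinematicSpace W m × ℝ) :
    regOmega L p χ V Z + regTimeTerm L p χ V Z =
      (∫ τ, varLam L p V τ (stepMul χ (χ τ) Z.1)) -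
        ∫ τ, varLam L p Z τ (stepMul χ (χ τ) V.1) := by
  have hdt : ∀ η, Integrable fun τ => dtLam L p.1 p.2 τ (stepMul χ (χ τ) η) := fun η => by
    simpa only [dtLam_eq_varLam] using hsum.integrable_varLam hL p (0, 1) χ η
  have hd : ∀ u η, Integrable fun τ => dLam L p.1 p.2 τ u (stepMul χ (χ τ) η) := fun u η => by
    simpa only [dLam_eq_varLam] using hsum.integrable_varLam hL p (u, 0) χ η
  have h1 : regOmega L p χ V Z = (∫ τ, dLam L p.1 p.2 τ V.1 (stepMul χ (χ τ) Z.1)) -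
      ∫ τ, dLam L p.1 p.2 τ Z.1 (stepMul χ (χ τ) V.1) := by
    rw [regOmega, ← integral_const_mul, ← integral_sub (hd _ _) (hd _ _)]
    congr 1
    ext τ
    rw [stepPairing, stepPairing, hL.dLam_stepMul _ _ _ χ (χ τ), hL.dLam_stepMul _ _ _ χ (χ τ),
      hL.dLam_comm _ _ _ (stepMul χ 0 V.1), hL.dLam_comm _ _ _ (stepMul χ 0 Z.1),
      hL.dLam_comm _ _ _ V.1 Z.1]
    ring
  have h2 : regTimeTerm L p χ V Z = V.2 * (∫ τ, dtLam L p.1 p.2 τ (stepMul χ (χ τ) Z.1)) -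
      Z.2 * ∫ τ, dtLam L p.1 p.2 τ (stepMul χ (χ τ) V.1) := by
    rw [regTimeTerm, ← integral_const_mul, ← integral_const_mul,
      ← integral_sub ((hdt _).const_mul _) ((hdt _).const_mul _)]
    congr 1
    ext τ
    rw [show V.2 • Z.1 - Z.2 • V.1 = V.2 • Z.1 + (-Z.2) • V.1 by module, stepMul_add_smul, hL.dtLam_add_smul]
    ring
  simp only [varLam]
  rw [integral_add (hd _ _) ((hdt _).const_mul _), integral_add (hd _ _) ((hdt _).const_mul _),
    integral_const_mul, integral_const_mul, h1, h2]
  ring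

theorem tendsto_regOmega_add_regTimeTerm (hL : IsSmoothLagrangian L)
    (hsum : IsSummableLagrangian L) (hV : V ∈ TangentSet L p) (hZ : Z ∈ TangentSet L p) :
    Tendsto (fun χ => regOmega L p χ V Z + regTimeTerm L p χ V Z) heavisideLimit
      (𝓝 (omega L p V Z)) := by
  have h := ((tendsto_const_nhds (x := omega L p V Z) (f := heavisideLimit)).sub
    (tendsto_stepError (hL.continuous_varLam p V Z.1))).add
    (tendsto_stepError (hL.continuous_varLam p Z V.1))
  rw [sub_zero, add_zero] at h
  refine h.congr fun χ => ?_
  rw [regOmega_add_regTimeTerm hL hsum, omega_eq hL hsum χ hV hZ, varMomentum, varMomentum]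
  ring

theorem regTimeTerm_eq_zero (χ : SmoothStep)
    (h : (∀ q t t', L q t = L q t') ∨ (V.2 = 0 ∧ Z.2 = 0)) : regTimeTerm L p χ V Z = 0 := by
  rw [regTimeTerm]
  refine integral_eq_zero_of_ae (ae_of_all _ fun τ => ?_)
  rcases h with h | ⟨h1, h2⟩
  · have : ∀ (q : KinematicSpace W m) (t t' : ℝ) (η : KinematicSpace W m),
        Lam L q t τ η = Lam L q t' τ η := fun q t t' η =>
      congrArg (fun f => deriv f 0) (funext fun r => h _ _ _)
    have hconst : (fun r => Lam L p.1 (p.2 + r) τ (stepMul χ (χ τ) (V.2 • Z.1 - Z.2 • V.1))) =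
        fun _ => Lam L p.1 p.2 τ (stepMul χ (χ τ) (V.2 • Z.1 - Z.2 • V.1)) :=
      funext fun r => this _ _ _ _
    simp [dtLam, hconst]
  · have h0 : stepMul χ (χ τ) (0 : KinematicSpace W m) = 0 := by
      simpa using stepMul_add_smul χ (χ τ) 0 0 (0 : KinematicSpace W m) 0
    simp [h1, h2, h0, dtLam, Lam]

end Formula

/-! ### Time evolution -/

section Evolution

variable {W : GrowthClass} {m : ℕ} {L : KinematicSpace W m → ℝ → ℝ}
  {p Z : KinematicSpace W m × ℝ}

theorem isSmoothFamily_shift (q : KinematicSpace W m) : IsSmoothFamily fun s : ℝ => shift s q :=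
  (isSmoothFamily_const (E := ℝ) q).shift_comp (.id ℝ ℝ) (.id ℝ ℝ)

theorem shift_shift_neg (ε : ℝ) (q : KinematicSpace W m) : shift ε (shift (-ε) q) = q := by
  refine Subtype.ext (funext fun σ => ?_)
  change q.1 (-ε + (ε + σ)) = q.1 σ
  rw [neg_add_cancel_left]

theorem hasDerivAt_shift (q : KinematicSpace W m) (σ : ℝ) :
    HasDerivAt (fun s => (shift s q).1 σ) ((velocity q).1 σ) 0 := by
  have hq : DifferentiableAt ℝ q.1 (0 + σ) :=
    (q.2.1 : ContDiff ℝ ∞ q.1).differentiable (by simp) _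
  have h := hq.hasDerivAt.comp_add_const 0 σ
  rw [zero_add] at h
  exact h

/-- By covariance of `Λ`, testing at the evolved point with `φ` is testing at `p` with a translate
of `φ`, up to the substitution `τ ↦ τ + ε`. -/
theorem evolution_mem (hp : p ∈ DynamicSpace L) (ε : ℝ) : evolution p ε ∈ DynamicSpace L := by
  intro φ hφ
  have hφ' : HasCompactSupport (shift (-ε) φ).1 :=
    hφ.comp_homeomorph (Homeomorph.addLeft (-ε))
  obtain ⟨h1, h2⟩ := hp _ hφ'
  have h : (fun τ => Lam L (evolution p ε).1 (evolution p ε).2 τ φ) =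
      fun τ => Lam L p.1 p.2 (τ + ε) (shift (-ε) φ) := by
    ext τ
    rw [← lam_evolution, shift_shift_neg]
    rfl
  rw [h]
  exact ⟨h1.comp_add_right ε, by rw [integral_add_right_eq_self
    (fun τ => Lam L p.1 p.2 τ (shift (-ε) φ)) ε, h2]⟩

theorem isCurve_evolution (hp : p ∈ DynamicSpace L) :
    IsCurve L (evolution p) p (generator p) where
  smooth_fst := isSmoothFamily_shift p.1
  smooth_snd := contDiff_const.add contDiff_id
  mem := evolution_mem hp
  base := Prod.ext (shift_zero p.1) (add_zero p.2)
  velocity_fst := hasDerivAt_shift p.1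
  velocity_snd := (hasDerivAt_id (0 : ℝ)).const_add p.2

/-- The step `σ ↦ χ(σ - ε)`. -/
def SmoothStep.translate (χ : SmoothStep) (ε : ℝ) : SmoothStep where
  toFun σ := χ (σ - ε)
  smooth := χ.smooth.comp (by fun_prop)
  mem_Icc σ := χ.mem_Icc _
  eventually_const := by
    obtain ⟨R, h0, h1⟩ := χ.eventually_const
    refine ⟨R + |ε|, fun σ h => h0 _ ?_, fun σ h => h1 _ ?_⟩
    · linarith [neg_abs_le ε]
    · linarith [le_abs_self ε]

theorem stepMul_shift (χ : SmoothStep) (a ε : ℝ) (η : KinematicSpace W m) :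
    stepMul χ a (shift ε η) = shift ε (stepMul (χ.translate ε) a η) := by
  refine Subtype.ext (funext fun σ => ?_)
  change (χ σ - a) • η.1 (ε + σ) = (χ (ε + σ - ε) - a) • η.1 (ε + σ)
  rw [add_sub_cancel_left]

theorem integral_heaviside_sub (f : ℝ → ℝ) (ε : ℝ) :
    ∫ τ, (heaviside τ - heaviside (τ - ε)) * f τ = ∫ τ in (0 : ℝ)..ε, f τ := by
  rcases le_total 0 ε with h | h
  · have : (fun τ => (heaviside τ - heaviside (τ - ε)) * f τ) = Set.indicator (Set.Ico 0 ε) f := by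
      ext τ
      simp only [heaviside, Set.indicator_apply, Set.mem_Ici, Set.mem_Ico, sub_nonneg]
      split_ifs <;> grind
    rw [this, integral_indicator measurableSet_Ico, integral_Ico_eq_integral_Ioc,
      intervalIntegral.integral_of_le h]
  · have : (fun τ => (heaviside τ - heaviside (τ - ε)) * f τ) =
        fun τ => -Set.indicator (Set.Ico ε 0) f τ := by
      ext τ
      simp only [heaviside, Set.indicator_apply, Set.mem_Ici, Set.mem_Ico, sub_nonneg]
      split_ifs <;> grind
    rw [this, integral_neg, integral_indicator measurableSet_Ico, integral_Ico_eq_integral_Ioc,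
      intervalIntegral.integral_of_ge h]

/-- The change of the momentum under time evolution. -/
theorem momentum_evolution (hL : IsSmoothLagrangian L) (hsum : IsSummableLagrangian L)
    (hp : p ∈ DynamicSpace L) (ε : ℝ) (η : KinematicSpace W m) :
    momentum L (evolution p ε) (shift ε η) =
      momentum L p η + ∫ τ in (0 : ℝ)..ε, Lam L p.1 p.2 τ η := by
  let χ := smoothStep 1 one_pos
  let χ' := χ.translate ε
  set f : ℝ → ℝ := fun τ => Lam L p.1 p.2 τ η with hf
  have hfc : Continuous f := hL.continuous_lam p.1 p.2 η
  have hχ' : ∀ τ, χ τ = χ' (τ + ε) := fun τ => by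
    change χ τ = χ (τ + ε - ε)
    rw [add_sub_cancel_right]
  -- Translating `σ` and `τ` together moves the step, so the same number is a regularized momentum
  -- at `p` with `χ'`.
  have h1 : regMomentum L (evolution p ε) χ (shift ε η) = regMomentum L p χ' η := by
    rw [regMomentum, regMomentum,
      ← integral_add_right_eq_self (fun τ => Lam L p.1 p.2 τ (stepMul χ' (χ' τ) η)) ε]
    congr 1
    ext τ
    rw [stepMul_shift, hχ', ← lam_evolution]
    rfl
  have he : ∀ τ, (χ τ - heaviside τ) * Lam L (evolution p ε).1 (evolution p ε).2 τ (shift ε η) =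
      (fun τ => (χ' τ - heaviside (τ - ε)) * f τ) (τ + ε) := fun τ => by
    simp only [hf, add_sub_cancel_right, ← hχ', ← lam_evolution]
    rfl
  have h2 : stepError χ (fun τ => Lam L (evolution p ε).1 (evolution p ε).2 τ (shift ε η)) =
      ∫ τ, (χ' τ - heaviside (τ - ε)) * f τ := by
    rw [stepError, ← integral_add_right_eq_self (fun τ => (χ' τ - heaviside (τ - ε)) * f τ) ε]
    exact congrArg _ (funext he)
  have hi : Integrable fun τ => (χ' τ - heaviside (τ - ε)) * f τ := by
    have := (integrable_step_sub_heaviside_mul χ (hL.continuous_lam (evolution p ε).1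
      (evolution p ε).2 (shift ε η))).comp_sub_right ε
    refine this.congr (ae_of_all _ fun τ => ?_)
    simp only [he, sub_add_cancel]
  -- The two points are given different steps, which makes the regularized parts equal. Only the
  -- errors differ, by the integral against `θ(τ) - θ(τ - ε)`, that is, over the interval between
  -- `0` and `ε`.
  rw [momentum_eq hL hsum (evolution_mem hp ε) χ, momentum_eq hL hsum hp χ', h1, h2,
    ← integral_heaviside_sub, add_assoc]
  congr 1
  rw [stepError, ← sub_eq_iff_eq_add',
    ← integral_sub hi (integrable_step_sub_heaviside_mul χ' hfc)]
  congr 1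
  ext τ
  ring

/-- Differentiation of `momentum_evolution` at `ε = 0`. On the left both the point and the test
trajectory move, the latter with velocity `η̇`; on the right the integrand at `τ = 0` is the
variation of `𝓛` itself. -/
theorem varMomentum_generator (hL : IsSmoothLagrangian L) (hsum : IsSummableLagrangian L)
    (hp : p ∈ DynamicSpace L) (χ : SmoothStep) (η : KinematicSpace W m) :
    varMomentum L χ p (generator p) η =
      dirDeriv L p.1 p.2 η - momentum L p (velocity η) := by
  obtain ⟨ζ, hζ, hηζ⟩ := (isSmoothFamily_shift η).exists_slope
  have hζ0 : ζ 0 = velocity η := Subtype.ext (funext fun σ =>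
    (hζ.slope_zero hηζ σ).unique (hasDerivAt_shift η σ))
  have h1 := (isCurve_evolution hp).hasDerivAt_momentum hL hsum (isSmoothFamily_shift η) hζ hηζ χ
  rw [hζ0, shift_zero] at h1
  have hf := hL.continuous_lam p.1 p.2 η
  have h2 : HasDerivAt (fun ε => momentum L p η + ∫ τ in (0 : ℝ)..ε, Lam L p.1 p.2 τ η)
      (Lam L p.1 p.2 0 η) 0 :=
    (intervalIntegral.integral_hasDerivAt_right (hf.intervalIntegrable _ _)
      (hf.stronglyMeasurableAtFilter _ _) hf.continuousAt).const_add _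
  simp only [← momentum_evolution hL hsum hp] at h2
  have h3 : Lam L p.1 p.2 0 η = dirDeriv L p.1 p.2 η := by
    simp only [Lam, dirDeriv, shift_zero, add_zero]
  rw [← h3, ← h1.unique h2]
  ring

theorem varHam_generator (hL : IsSmoothLagrangian L) (hsum : IsSummableLagrangian L)
    (hp : p ∈ DynamicSpace L) (χ : SmoothStep) :
    varHam L χ p (generator p) = -timeDeriv L p.1 p.2 := by
  rw [varHam, varMomentum_generator hL hsum hp]
  simp only [generator]
  ring

/-- With `δ_X P` and `δ_X h` inserted, `ω(X, Z)` and `-(δ_X h) δt` leave exactly `-δ_Z h`, which the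
term `+δ_Z h` coming from `X.2 = 1` cancels. -/
theorem omegaPrime_generator (hL : IsSmoothLagrangian L) (hsum : IsSummableLagrangian L)
    (hp : p ∈ DynamicSpace L) (hZ : Z ∈ TangentSet L p) :
    omegaPrime L p (generator p) Z = 0 := by
  let χ := smoothStep 1 one_pos
  have hX : generator p ∈ TangentSet L p := ⟨_, isCurve_evolution hp⟩
  rw [omegaPrime_eq hL hsum χ hX hZ, omega_eq hL hsum χ hX hZ, varHam_generator hL hsum hp,
    varMomentum_generator hL hsum hp, varHam]
  simp only [generator]
  ring

end Evolution
end NonlocalMechanics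

open NonlocalMechanics in
theorem mainTheorem3 (W : GrowthClass) (m : ℕ) (L : KinematicSpace W m → ℝ → ℝ)
    (hL : IsSmoothLagrangian L) (hsum : IsSummableLagrangian L)
    (p : KinematicSpace W m × ℝ) (hp : p ∈ DynamicSpace L) :
    -- the momentum, hence `j`, is well defined on the dynamic space
    IsMomentum L p (momentum L p) ∧
    -- the explicit formula for the reduced Hamiltonian `h = H ∘ j`
    Tendsto (fun χ => regMomentum L p χ (velocity p.1) - L p.1 p.2) heavisideLimit
      (𝓝 (redHam L p)) ∧
    -- `j` and `h` are differentiable on the dynamic space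
    (∀ V ∈ TangentSet L p, IsPushforward L p V (pushforward L p V) ∧
      HasDifferential L (redHam L) p V (differential L (redHam L) p V)) ∧
    -- `ω'` is a 2-form
    (∀ V ∈ TangentSet L p, ∀ Z ∈ TangentSet L p,
      omegaPrime L p V Z = -omegaPrime L p Z V) ∧
    (∀ V₁ ∈ TangentSet L p, ∀ V₂ ∈ TangentSet L p, ∀ Z ∈ TangentSet L p, ∀ a b : ℝ,
      a • V₁ + b • V₂ ∈ TangentSet L p →
      omegaPrime L p (a • V₁ + b • V₂) Z = a * omegaPrime L p V₁ Z + b * omegaPrime L p V₂ Z) ∧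
    -- `ω' = ω - δh ∧ δt`
    (∀ V ∈ TangentSet L p, ∀ Z ∈ TangentSet L p,
      omegaPrime L p V Z = omega L p V Z -
        (differential L (redHam L) p V * Z.2 - differential L (redHam L) p Z * V.2)) ∧
    -- the explicit formula for `ω`
    (∀ V ∈ TangentSet L p, ∀ Z ∈ TangentSet L p,
      Tendsto (fun χ => regOmega L p χ V Z + regTimeTerm L p χ V Z) heavisideLimit
        (𝓝 (omega L p V Z)) ∧
      (((∀ q t t', L q t = L q t') ∨ (V.2 = 0 ∧ Z.2 = 0)) →
        Tendsto (fun χ => regOmega L p χ V Z) heavisideLimit (𝓝 (omega L p V Z)))) ∧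
    -- the generator of time evolution is tangent to the dynamic space and `i_X ω' = 0`
    IsCurve L (evolution p) p (generator p) ∧
    ∀ Z ∈ TangentSet L p, omegaPrime L p (generator p) Z = 0 := by
  refine ⟨isMomentum_momentum hL hsum hp, ?_, fun V hV => ?_, fun V _ Z _ => ?_,
    fun V₁ h₁ V₂ h₂ Z hZ a b h => omegaPrime_add_smul hL hsum h₁ h₂ hZ a b h, fun V hV Z hZ => ?_,
    fun V hV Z hZ => ?_, isCurve_evolution hp, fun Z hZ => omegaPrime_generator hL hsum hp hZ⟩
  · exact (isMomentum_momentum hL hsum hp (velocity p.1)).sub_const _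
  · exact ⟨isPushforward_pushforward hL hsum hV,
      hasDifferential_differential (hasDifferential_redHam hL hsum (smoothStep 1 one_pos))⟩
  · simp only [omegaPrime, OmegaPrime, Omega]
    ring
  · rw [omegaPrime_eq hL hsum (smoothStep 1 one_pos) hV hZ,
      differential_redHam hL hsum (smoothStep 1 one_pos) hV,
      differential_redHam hL hsum (smoothStep 1 one_pos) hZ]
  · have h := tendsto_regOmega_add_regTimeTerm hL hsum hV hZ
    refine ⟨h, fun h0 => h.congr fun χ => ?_⟩
    rw [regTimeTerm_eq_zero χ h0, add_zero]
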